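/- For $n\ge 1$ and $\alpha,\beta\in(0,1)$ put $\mu_{n,\alpha}=2^{\alpha}\pi^{-n/2}\,\Gamma(\frac{n+\alpha+1}{2})/\Gamma(\frac{1-\alpha}{2})$ and $\nu_{n,\beta}=2^{\beta}\pi^{-n/2}\,\Gamma(\frac{n+\beta}{2})/\Gamma(-\frac{\beta}{2})$. For $\varphi\in C_c^\infty(\mathbb R^n;\mathbb R^n)$ let $$\operatorname{div}^\alpha\varphi(x)=\mu_{n,\alpha}\int_{\mathbb R^n}\frac{(y-x)\cdot(\varphi(y)-\varphi(x))}{|y-x|^{n+\alpha+1}}\,dy .$$ Let $BV^\alpha(\mathbb R^n)$ be the space of $f\in L^1(\mathbb R^n)$ with $\sup\{\int f\operatorname{div}^\alpha\varphi\,dx:\varphi\in C_c^\infty(\mathbb R^n;\mathbb R^n),\ \|\varphi\|_{L^\infty}\le 1\}<\infty$. Let $S^{\alpha,1}(\mathbb R^n)$ be the space of $f\in L^1(\mathbb R^n)$ for which there is $g\in L^1(\mathbb R^n;\mathbb R^n)$ with $\int f\operatorname{div}^\alpha\varphi\,dx=-\int g\cdot\varphi\,dx$ for all $\varphi\in C_c^\infty(\mathbb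 R^n;\mathbb R^n)$. Let $W^{\alpha,1}(\mathbb R^n)$ be the space of $u\in L^1(\mathbb R^n)$ with $\iint |u(x)-u(y)|\,|x-y|^{-n-\alpha}\,dx\,dy<\infty$. For $u\in W^{\beta,1}(\mathbb R^n)$ let $$(-\Delta)^{\beta/2}u(x)=\nu_{n,\beta}\int_{\mathbb R^n}\frac{u(x+h)-u(x)}{|h|^{n+\beta}}\,dh ,$$ which converges absolutely for a.e. $x$. For a finite $\mathbb R^n$-valued Radon measure $\mu$ write $Du=\mu$, respectively $D^\alpha f=\mu$, if $\int u\operatorname{div}\varphi\,dx=-\int\varphi\cdot d\mu$, respectively $\int f\operatorname{div}^\alpha\varphi\,dx=-\int\varphi\cdot d\mu$, for all $\varphi\in C_c^\infty(\mathbb R^n;\mathbb R^n)$. \textbf{Theorem.} Let $n\ge1$ and $\alpha\in(0,1)$. The inclusion $S^{\alpha,1}(\mathbb R^n)\subset BV^\alpha(\mathbb R^n)$ holds and is strict, and so does and is the inclusion $W^{\alpha,1}(\mathbb R^n)\subset BV^\alpha(\mathbb R^n)$. More precisely, $BV(\mathbb R^n)\setminus W^{1,1}(\mathbb R^n)$ is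 non-empty, and every $u\in BV(\mathbb R^n)\setminus W^{1,1}(\mathbb R^n)$ belongs to $W^{1-\alpha,1}(\mathbb R^n)$, the function $f:=(-\Delta)^{\frac{1-\alpha}{2}}u$ belongs to $BV^\alpha(\mathbb R^n)\setminus S^{\alpha,1}(\mathbb R^n)$, and $D^\alpha f=Du$, where the total variation $|D^\alpha f|=|Du|$ is not absolutely continuous with respect to Lebesgue measure. -/

import Mathlib

open MeasureTheory
open scoped ENNReal ContDiff RealInnerProductSpace

noncomputable section

namespace FracBV

/-- `ℝⁿ` with the Euclidean norm and inner product. -/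
abbrev E (n : ℕ) : Type := EuclideanSpace ℝ (Fin n)

/-- `φ ∈ C_c^∞(ℝⁿ; ℝⁿ)`. -/
def IsTestField {n : ℕ} (φ : E n → E n) : Prop :=
  ContDiff ℝ ∞ φ ∧ HasCompactSupport φ

/-- The classical divergence `div φ = ∑ᵢ ∂ᵢ φᵢ`. -/
def divergence {n : ℕ} (φ : E n → E n) (x : E n) : ℝ :=
  ∑ i : Fin n, (fderiv ℝ φ x (EuclideanSpace.single i (1 : ℝ))) i

/-- `μ_{n,α} = 2^α π^{-n/2} Γ((n+α+1)/2) / Γ((1-α)/2)`. -/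
def muConst (n : ℕ) (α : ℝ) : ℝ :=
  2 ^ α * Real.pi ^ (-(n : ℝ) / 2) * (Real.Gamma (((n : ℝ) + α + 1) / 2) / Real.Gamma ((1 - α) / 2))

/-- `ν_{n,β} = 2^β π^{-n/2} Γ((n+β)/2) / Γ(-β/2)`. -/
def nuConst (n : ℕ) (β : ℝ) : ℝ :=
  2 ^ β * Real.pi ^ (-(n : ℝ) / 2) * (Real.Gamma (((n : ℝ) + β) / 2) / Real.Gamma (-β / 2))

/-- The fractional divergence
`div^α φ (x) = μ_{n,α} ∫ (y - x) · (φ(y) - φ(x)) / |y - x|^{n+α+1} dy`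
(an absolutely convergent integral for every test field `φ`). -/
def fracDiv {n : ℕ} (α : ℝ) (φ : E n → E n) (x : E n) : ℝ :=
  muConst n α * ∫ y : E n, ⟪y - x, φ y - φ x⟫ / ‖y - x‖ ^ ((n : ℝ) + α + 1)

/-- The fractional Laplacian of order `β ∈ (0,1)`,
`(-Δ)^{β/2} u (x) = ν_{n,β} ∫ (u(x+h) - u(x)) / |h|^{n+β} dh`
(for `u ∈ W^{β,1}(ℝⁿ)` the integral converges absolutely for a.e. `x`). -/
def fracLaplacian {n : ℕ} (β : ℝ) (u : E n → ℝ) (x : E n) : ℝ :=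
  nuConst n β * ∫ h : E n, (u (x + h) - u x) / ‖h‖ ^ ((n : ℝ) + β)

/-- The variation `|Du|(ℝⁿ) = sup {∫ u div φ : φ ∈ C_c^∞(ℝⁿ; ℝⁿ), ‖φ‖_∞ ≤ 1}`. -/
def variation {n : ℕ} (u : E n → ℝ) : ℝ≥0∞ :=
  ⨆ (φ : E n → E n) (_ : IsTestField φ) (_ : ∀ x, ‖φ x‖ ≤ 1),
    ENNReal.ofReal (∫ x, u x * divergence φ x)

/-- The fractional variation
`|D^α f|(ℝⁿ) = sup {∫ f div^α φ : φ ∈ C_c^∞(ℝⁿ; ℝⁿ), ‖φ‖_∞ ≤ 1}`. -/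
def fracVariation {n : ℕ} (α : ℝ) (f : E n → ℝ) : ℝ≥0∞ :=
  ⨆ (φ : E n → E n) (_ : IsTestField φ) (_ : ∀ x, ‖φ x‖ ≤ 1),
    ENNReal.ofReal (∫ x, f x * fracDiv α φ x)

/-- `BV(ℝⁿ)`. -/
def BV (n : ℕ) : Set (E n → ℝ) :=
  {u | MemLp u 1 volume ∧ variation u < ⊤}

/-- `W^{1,1}(ℝⁿ)`: functions in `L¹` that have a weak gradient in `L¹`. -/
def W11 (n : ℕ) : Set (E n → ℝ) :=
  {u | MemLp u 1 volume ∧ ∃ g : E n → E n, MemLp g 1 volume ∧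
    ∀ φ : E n → E n, IsTestField φ →
      ∫ x, u x * divergence φ x = -∫ x, ⟪g x, φ x⟫}

/-- `BV^α(ℝⁿ)`. -/
def fracBV (n : ℕ) (α : ℝ) : Set (E n → ℝ) :=
  {f | MemLp f 1 volume ∧ fracVariation α f < ⊤}

/-- `S^{α,1}(ℝⁿ)`: functions in `L¹` that have a weak `α`-gradient in `L¹`. -/
def fracS (n : ℕ) (α : ℝ) : Set (E n → ℝ) :=
  {f | MemLp f 1 volume ∧ ∃ g : E n → E n, MemLp g 1 volume ∧
    ∀ φ : E n → E n, IsTestField φ →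
      ∫ x, f x * fracDiv α φ x = -∫ x, ⟪g x, φ x⟫}

/-- The fractional Sobolev space `W^{α,1}(ℝⁿ)`. -/
def fracW (n : ℕ) (α : ℝ) : Set (E n → ℝ) :=
  {u | MemLp u 1 volume ∧
    ∫⁻ x : E n, ∫⁻ y : E n, ENNReal.ofReal (|u x - u y| / ‖x - y‖ ^ ((n : ℝ) + α)) < ⊤}

/-- The pairing `∫ φ · dμ` of a vector field with an `ℝⁿ`-valued measure. -/
def pairing {n : ℕ} (φ : E n → E n) (μ : VectorMeasure (E n) (E n)) : ℝ :=
  μ.integral φ (innerSL ℝ)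

/-- `Du = μ`: the finite `ℝⁿ`-valued Radon measure `μ` is the distributional gradient of `u`. -/
def IsGradientMeasure {n : ℕ} (u : E n → ℝ) (μ : VectorMeasure (E n) (E n)) : Prop :=
  IsFiniteMeasure μ.variation ∧ ∀ φ : E n → E n, IsTestField φ →
    ∫ x, u x * divergence φ x = -pairing φ μ

/-- `D^α f = μ`: the finite `ℝⁿ`-valued Radon measure `μ` is the distributional `α`-gradient
of `f`. -/
def IsFracGradientMeasure {n : ℕ} (α : ℝ) (f : E n → ℝ) (μ : VectorMeasure (E n) (E n)) : Prop :=
  IsFiniteMeasure μ.variation ∧ ∀ φ : E n → E n, IsTestField φ →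
    ∫ x, f x * fracDiv α φ x = -pairing φ μ

end FracBV

end

/-!
The operator `(-Δ)^{(1-α)/2}` turns an ordinary gradient into a fractional one. On the Fourier side
it is multiplication by `(2π|ξ|)^{1-α}`, while the `i`-th term of `div^α` is multiplication by
`2πi ξᵢ (2π|ξ|)^{α-1}`; the product is `2πi ξᵢ`, the symbol of `∂ᵢ`. Hence
`∫ (-Δ)^{(1-α)/2} u div^α φ = ∫ u div φ` for every test field `φ`
(`integral_fracLaplacian_mul_fracDiv`), and with `f = (-Δ)^{(1-α)/2} u` the conditions
`f ∈ BV^α`, `f ∈ S^{α,1}`, `D^α f = μ` become the conditions `u ∈ BV`, `u ∈ W^{1,1}`, `Du = μ`.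

Both symbols (`nuConst_mul_symbol`, `muConst_mul_symbol`) come from writing `|z|^{-2a}` as a
superposition of Gaussians `e^{-s|z|²}` (`gaussian_subordination`), whose Fourier transforms are
explicit; what remains are Gamma integrals in `s`. For `u ∈ BV` the singular integral is absolutely
convergent, because `‖u(· + z) - u‖_{L¹} ≤ min(2 ‖u‖_{L¹}, |z| |Du|(ℝⁿ))`
(`integral_abs_translate_sub_le`); this also gives `BV ⊂ W^{1-α,1}`.

The inclusion `S^{α,1} ⊂ BV^α` is immediate, and `W^{α,1} ⊂ S^{α,1}` is integration by parts for the
odd kernel `z |z|^{-n-α-1}`, by Fubini's theorem. Both inclusions into `BV^α` are strict because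
`(-Δ)^{(1-α)/2} u ∉ S^{α,1}` for `u ∈ BV \ W^{1,1}`, and the indicator function of the unit ball is
such a `u`: a weak gradient of it would vanish off the sphere, hence almost everywhere.

The gradient measure of `u ∈ BV` is obtained from the difference quotients of `u`, which are bounded
in `L¹`: their positive and negative parts converge weakly-* along an ultrafilter, and the limits
are finite measures by the Riesz representation theorem (`exists_measure_partial`). If the total
variation were absolutely continuous with respect to Lebesgue measure, the Radon–Nikodym density
would be a weak gradient in `L¹` (`exists_isGradientMeasure`), so `u ∈ W^{1,1}`.
-/

namespace FracBV

open Filter Topology Set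
open scoped Real FourierTransform CompactlySupported

variable {n : ℕ}

/-! ### Test functions, bounded variation and translations in `L¹` -/

/-- `ψ ∈ C_c^∞(ℝⁿ)`, scalar test functions. -/
def IsTestFun (ψ : E n → ℝ) : Prop :=
  ContDiff ℝ ∞ ψ ∧ HasCompactSupport ψ

lemma IsTestFun.continuous {ψ : E n → ℝ} (hψ : IsTestFun ψ) : Continuous ψ := hψ.1.continuous

lemma IsTestFun.integrable {ψ : E n → ℝ} (hψ : IsTestFun ψ) : Integrable ψ :=
  hψ.continuous.integrable_of_hasCompactSupport hψ.2

lemma IsTestFun.differentiable {ψ : E n → ℝ} (hψ : IsTestFun ψ) : Differentiable ℝ ψ :=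
  hψ.1.differentiable (by simp)

lemma IsTestFun.fderiv_apply {ψ : E n → ℝ} (hψ : IsTestFun ψ) (v : E n) :
    IsTestFun (fun x => fderiv ℝ ψ x v) :=
  ⟨(hψ.1.fderiv_right (m := ∞) (by simp)).clm_apply contDiff_const, hψ.2.fderiv_apply ℝ v⟩

lemma IsTestFun.exists_bound {ψ : E n → ℝ} (hψ : IsTestFun ψ) :
    ∃ C, 0 ≤ C ∧ ∀ x, |ψ x| ≤ C := by
  obtain ⟨C, hC⟩ := hψ.2.exists_bound_of_continuous hψ.continuous
  exact ⟨C, (norm_nonneg _).trans (hC 0), hC⟩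

lemma IsTestFun.exists_fderiv_bound {ψ : E n → ℝ} (hψ : IsTestFun ψ) :
    ∃ C, 0 ≤ C ∧ ∀ x, ‖fderiv ℝ ψ x‖ ≤ C := by
  obtain ⟨C, hC⟩ := (hψ.2.fderiv ℝ).exists_bound_of_continuous
    (hψ.1.continuous_fderiv (by simp))
  exact ⟨C, (norm_nonneg _).trans (hC 0), hC⟩

lemma IsTestFun.comp_add {ψ : E n → ℝ} (hψ : IsTestFun ψ) (z : E n) :
    IsTestFun (fun x => ψ (x + z)) :=
  ⟨hψ.1.comp (contDiff_id.add contDiff_const),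
    hψ.2.comp_homeomorph (Homeomorph.addRight z)⟩

lemma fderiv_comp_add (ψ : E n → ℝ) (z x : E n) :
    fderiv ℝ (fun x => ψ (x + z)) x = fderiv ℝ ψ (x + z) := by
  simpa using fderiv_comp_add_right (𝕜 := ℝ) (f := ψ) (x := x) z

lemma IsTestField.component {φ : E n → E n} (hφ : IsTestField φ) (i : Fin n) :
    IsTestFun (fun x => φ x i) :=
  ⟨(EuclideanSpace.proj (𝕜 := ℝ) i).contDiff.comp hφ.1,
    hφ.2.comp_left (g := fun v : E n => v i) rfl⟩

lemma divergence_eq_sum {φ : E n → E n} (hφ : IsTestField φ) (x : E n) :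
    divergence φ x =
      ∑ i, fderiv ℝ (fun x => φ x i) x (EuclideanSpace.single i (1 : ℝ)) := by
  refine Finset.sum_congr rfl fun i _ => ?_
  have h := ((EuclideanSpace.proj (𝕜 := ℝ) i).hasFDerivAt.comp x
    ((hφ.1.differentiable (by simp)).differentiableAt (x := x)).hasFDerivAt).fderiv
  have h' : fderiv ℝ (fun x => φ x i) x =
      (EuclideanSpace.proj (𝕜 := ℝ) i).comp (fderiv ℝ φ x) := h
  rw [h']; rfl

lemma IsTestFun.smul_const {ψ : E n → ℝ} (hψ : IsTestFun ψ) (v : E n) :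
    IsTestField (fun x => ψ x • v) :=
  ⟨hψ.1.smul contDiff_const, hψ.2.smul_right⟩

lemma divergence_smul_const {ψ : E n → ℝ} (hψ : IsTestFun ψ) (v x : E n) :
    divergence (fun x => ψ x • v) x = fderiv ℝ ψ x v := by
  rw [divergence_eq_sum (hψ.smul_const v)]
  have h : ∀ i, fderiv ℝ (fun x => (ψ x • v) i) x (EuclideanSpace.single i (1 : ℝ)) =
      v i * fderiv ℝ ψ x (EuclideanSpace.single i (1 : ℝ)) := by
    intro i
    have : (fun x => (ψ x • v) i) = fun x => ψ x * v i := by ext; simp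
    rw [this, fderiv_mul_const hψ.differentiable.differentiableAt]
    simp
  simp_rw [h]
  conv_rhs => rw [← (EuclideanSpace.basisFun (Fin n) ℝ).sum_repr v, map_sum]
  simp

lemma IsTestFun.integrable_mul {ψ u : E n → ℝ} (hψ : IsTestFun ψ) (hu : Integrable u) :
    Integrable (fun x => u x * ψ x) := by
  obtain ⟨C, -, hC⟩ := hψ.exists_bound
  exact hu.mul_bdd hψ.continuous.aestronglyMeasurable (Eventually.of_forall hC)

lemma integral_mul_divergence {φ : E n → E n} (hφ : IsTestField φ) {u : E n → ℝ}
    (hu : Integrable u) :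
    ∫ x, u x * divergence φ x =
      ∑ i, ∫ x, u x * fderiv ℝ (fun x => φ x i) x (EuclideanSpace.single i (1 : ℝ)) := by
  rw [← integral_finsetSum]
  · simp_rw [divergence_eq_sum hφ, Finset.mul_sum]
  · exact fun i _ => ((hφ.component i).fderiv_apply _).integrable_mul hu

/-- Differentiation of the pairing of an integrable function with the translates of a test
function. -/
lemma hasDerivAt_integral_mul_translate {u ψ : E n → ℝ} (hu : Integrable u) (hψ : IsTestFun ψ)
    (v : E n) (t : ℝ) :
    HasDerivAt (fun s : ℝ => ∫ x, u x * ψ (x + s • v))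
      (∫ x, u x * fderiv ℝ ψ (x + t • v) v) t := by
  obtain ⟨C, hC0, hC⟩ := hψ.exists_fderiv_bound
  refine (hasDerivAt_integral_of_dominated_loc_of_deriv_le (s := Set.univ)
    (F := fun s x => u x * ψ (x + s • v)) (F' := fun s x => u x * fderiv ℝ ψ (x + s • v) v)
    (bound := fun x => |u x| * (C * ‖v‖)) univ_mem ?_ ?_ ?_ ?_ ?_ ?_).2
  · exact Eventually.of_forall fun s => ((hψ.comp_add (s • v)).integrable_mul hu).aestronglyMeasurable
  · exact (hψ.comp_add (t • v)).integrable_mul hu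
  · exact (((hψ.fderiv_apply v).comp_add (t • v)).integrable_mul hu).aestronglyMeasurable
  · refine Eventually.of_forall fun x s _ => ?_
    rw [norm_mul, Real.norm_eq_abs]
    gcongr
    exact (fderiv ℝ ψ (x + s • v)).le_of_opNorm_le (hC _) v
  · exact hu.abs.mul_const _
  · refine Eventually.of_forall fun x s _ => ?_
    have h1 : HasDerivAt (fun s : ℝ => x + s • v) v s := by
      simpa using ((hasDerivAt_id s).smul_const v).const_add x
    have h2 : HasDerivAt (fun s : ℝ => ψ (x + s • v)) (fderiv ℝ ψ (x + s • v) v) s :=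
      HasFDerivAt.comp_hasDerivAt (l := ψ) (f := fun s : ℝ => x + s • v) s
        (hψ.differentiable (x + s • v)).hasFDerivAt h1
    exact h2.const_mul (u x)

lemma integral_mul_divergence_le {u : E n → ℝ} (hu : variation u < ⊤) {φ : E n → E n}
    (hφ : IsTestField φ) {M : ℝ} (hM : 0 < M) (hb : ∀ x, ‖φ x‖ ≤ M) :
    ∫ x, u x * divergence φ x ≤ M * (variation u).toReal := by
  have hφ' : IsTestField (fun x => M⁻¹ • φ x) := ⟨hφ.1.const_smul M⁻¹,
    hφ.2.comp_left (g := fun v : E n => M⁻¹ • v) (smul_zero _)⟩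
  have hd : ∀ x, divergence (fun x => M⁻¹ • φ x) x = M⁻¹ * divergence φ x := by
    intro x
    simp only [divergence, Finset.mul_sum]
    refine Finset.sum_congr rfl fun i _ => ?_
    rw [fderiv_fun_const_smul ((hφ.1.differentiable (by simp)).differentiableAt)]
    simp
  have h1 : ENNReal.ofReal (∫ x, u x * divergence (fun x => M⁻¹ • φ x) x) ≤ variation u := by
    refine le_iSup_of_le _ (le_iSup_of_le hφ' (le_iSup_of_le (fun x => ?_) le_rfl))
    rw [norm_smul, norm_inv, Real.norm_of_nonneg hM.le, inv_mul_le_iff₀ hM, mul_one]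
    exact hb x
  have h2 := (ENNReal.ofReal_le_iff_le_toReal hu.ne).1 h1
  simp_rw [hd] at h2
  have h3 : ∫ x, u x * (M⁻¹ * divergence φ x) = M⁻¹ * ∫ x, u x * divergence φ x := by
    rw [← integral_const_mul]; congr 1; ext x; ring
  rwa [h3, inv_mul_le_iff₀ hM] at h2

/-- Duality: the `L¹` norm is controlled by pairings with test functions of sup norm at most one. -/
lemma integral_abs_le_of_forall_test {w : E n → ℝ} (hw : Integrable w) {M : ℝ}
    (h : ∀ ψ, IsTestFun ψ → (∀ x, |ψ x| ≤ 1) → ∫ x, w x * ψ x ≤ M) :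
    ∫ x, |w x| ≤ M := by
  refine le_of_forall_pos_le_add fun ε hε => ?_
  obtain ⟨g, hgc, hgs, hg⟩ := (memLp_one_iff_integrable.2 hw).exist_eLpNorm_sub_le
    ENNReal.one_ne_top le_rfl (show 0 < ε / 3 by positivity)
  have hgT : IsTestFun g := ⟨hgs, hgc⟩
  have hwgi : Integrable fun x => |w x - g x| := (hw.sub hgT.integrable).abs
  have hwg : ∫ x, |w x - g x| ≤ ε / 3 := by
    have := hg
    rw [eLpNorm_one_eq_lintegral_enorm] at this
    rw [integral_eq_lintegral_of_nonneg_ae (Eventually.of_forall fun x => abs_nonneg _)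
      hwgi.aestronglyMeasurable]
    refine ENNReal.toReal_le_of_le_ofReal (by positivity) (le_trans (le_of_eq ?_) this)
    congr 1; ext x; simp [Real.enorm_eq_ofReal_abs]
  -- a smooth regularisation of the sign of `g`
  set V : ℝ := (volume (tsupport g)).toReal
  have hVfin : volume (tsupport g) < ⊤ := hgc.isCompact.measure_lt_top
  -- `δ` is such that `δ V ≤ ε / 3`, also when `V = 0`
  set δ : ℝ := ε / (3 * (V + 1))
  have hV0 : 0 ≤ V := ENNReal.toReal_nonneg
  have hδ : 0 < δ := by positivity
  have hpos : ∀ x, 0 < g x ^ 2 + δ ^ 2 := fun x => by positivity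
  set ψ : E n → ℝ := fun x => g x / Real.sqrt (g x ^ 2 + δ ^ 2)
  have hsq : ∀ x, |g x| ≤ Real.sqrt (g x ^ 2 + δ ^ 2) := fun x =>
    Real.abs_le_sqrt (by nlinarith [sq_nonneg δ])
  have hψ : IsTestFun ψ := by
    constructor
    · exact hgs.div (((hgs.pow 2).add contDiff_const).sqrt fun x => (hpos x).ne')
        fun x => (Real.sqrt_pos.2 (hpos x)).ne'
    · have : ψ = fun x => g x * (Real.sqrt (g x ^ 2 + δ ^ 2))⁻¹ := by
        ext x; simp [ψ, div_eq_mul_inv]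
      rw [this]; exact hgc.mul_right
  have hψ1 : ∀ x, |ψ x| ≤ 1 := fun x => by
    simp only [ψ, abs_div, abs_of_pos (Real.sqrt_pos.2 (hpos x))]
    exact div_le_one_of_le₀ (hsq x) (Real.sqrt_nonneg _)
  have hpt : ∀ x, |g x| ≤ g x * ψ x + (tsupport g).indicator (fun _ => δ) x := by
    intro x
    by_cases hx : x ∈ tsupport g
    · rw [Set.indicator_of_mem hx]
      have hs := Real.sqrt_pos.2 (hpos x)
      have h1 : Real.sqrt (g x ^ 2 + δ ^ 2) ≤ |g x| + δ := by
        rw [Real.sqrt_le_left (by positivity)]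
        nlinarith [abs_nonneg (g x), sq_abs (g x)]
      have h2 : g x * ψ x = |g x| ^ 2 / Real.sqrt (g x ^ 2 + δ ^ 2) := by
        simp only [ψ, sq_abs]; ring
      rw [h2]
      have h3 : |g x| - δ ≤ |g x| ^ 2 / Real.sqrt (g x ^ 2 + δ ^ 2) := by
        rw [le_div_iff₀ hs]
        rcases le_total (|g x|) δ with h | h
        · nlinarith [sq_nonneg (|g x|)]
        · nlinarith [sq_nonneg δ]
      linarith
    · simp [Set.indicator_of_notMem hx, image_eq_zero_of_notMem_tsupport hx]
  have hind : Integrable ((tsupport g).indicator (fun _ => δ)) volume :=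
    (integrable_indicator_iff (isClosed_tsupport g).measurableSet).2
      (integrableOn_const hVfin.ne)
  have hindv : ∫ x, (tsupport g).indicator (fun _ => δ) x ≤ ε / 3 := by
    rw [integral_indicator_const _ (isClosed_tsupport g).measurableSet]
    change V • δ ≤ _
    rw [smul_eq_mul]
    simp only [δ]
    rw [mul_div_assoc', div_le_div_iff₀ (by positivity) (by positivity)]
    nlinarith
  have hgψ := hψ.integrable_mul hgT.integrable
  have hwψ := hψ.integrable_mul hw
  have hdiff : ∫ x, g x * ψ x ≤ ∫ x, w x * ψ x + |w x - g x| := by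
    refine integral_mono hgψ (hwψ.add hwgi) fun x => ?_
    have : (g x - w x) * ψ x ≤ |w x - g x| := by
      refine (le_abs_self _).trans ?_
      rw [abs_mul, abs_sub_comm]
      exact mul_le_of_le_one_right (abs_nonneg _) (hψ1 x)
    simp only; linarith
  rw [integral_add hwψ hwgi] at hdiff
  have hgψi : Integrable fun x => g x * ψ x + (tsupport g).indicator (fun _ => δ) x :=
    hgψ.add hind
  have h4 : ∫ x, |w x| ≤ ∫ x, |w x - g x| + (g x * ψ x + (tsupport g).indicator (fun _ => δ) x) := by
    refine integral_mono hw.abs (hwgi.add hgψi) fun x => ?_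
    have := abs_sub_abs_le_abs_sub (w x) (g x)
    have := hpt x
    simp only; linarith
  rw [integral_add hwgi hgψi, integral_add hgψ hind] at h4
  have := h ψ hψ hψ1
  linarith

lemma integral_translate_sub_mul {u ψ : E n → ℝ} (hu : Integrable u) (hψ : IsTestFun ψ)
    (z : E n) :
    ∫ x, (u (x + z) - u x) * ψ x = ∫ x, u x * (ψ (x - z) - ψ x) := by
  simp_rw [sub_mul, mul_sub]
  have h2 : Integrable fun x => u x * ψ (x - z) := by
    simpa [sub_eq_add_neg] using (hψ.comp_add (-z)).integrable_mul hu
  rw [integral_sub (hψ.integrable_mul (hu.comp_add_right z)) (hψ.integrable_mul hu),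
    integral_sub h2 (hψ.integrable_mul hu)]
  congr 1
  rw [← integral_add_right_eq_self (fun x => u x * ψ (x - z)) z]
  simp

/-- The translation estimate characterising functions of bounded variation. -/
lemma integral_abs_translate_sub_le {u : E n → ℝ} (hu : Integrable u) (hV : variation u < ⊤)
    (z : E n) : ∫ x, |u (x + z) - u x| ≤ ‖z‖ * (variation u).toReal := by
  rcases eq_or_ne z 0 with rfl | hz
  · simp
  refine integral_abs_le_of_forall_test ((hu.comp_add_right z).sub hu) fun ψ hψ hψ1 => ?_
  change ∫ x, (u (x + z) - u x) * ψ x ≤ _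
  rw [integral_translate_sub_mul hu hψ]
  have hd := hasDerivAt_integral_mul_translate hu hψ (-z)
  have hb : ∀ t : ℝ, ∫ x, u x * fderiv ℝ ψ (x + t • -z) (-z) ≤ ‖z‖ * (variation u).toReal := by
    intro t
    have hψt := hψ.comp_add (t • -z)
    have h := integral_mul_divergence_le hV (hψt.smul_const (-z)) (norm_pos_iff.2 hz)
      (fun x => by
        rw [norm_smul, norm_neg, Real.norm_eq_abs]
        exact mul_le_of_le_one_left (norm_nonneg _) (hψ1 _))
    simpa only [divergence_smul_const hψt, fderiv_comp_add] using h
  -- mean value inequality for `t ↦ ∫ u ψ(· - t z)` on `[0, 1]`; its derivative tests `u` against the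
  -- divergence of the field `-ψ(· - t z) z`, of sup norm at most `|z|`
  have hmv := Convex.image_sub_le_mul_sub_of_deriv_le (D := Set.univ) convex_univ
    (f := fun s : ℝ => ∫ x, u x * ψ (x + s • -z)) (C := ‖z‖ * (variation u).toReal)
    (fun t _ => (hd t).continuousAt.continuousWithinAt)
    (fun t _ => (hd t).differentiableAt.differentiableWithinAt)
    (fun t _ => by rw [(hd t).deriv]; exact hb t) 0 trivial 1 trivial zero_le_one
  simp only [one_smul, zero_smul, add_zero, sub_zero, mul_one] at hmv
  simp_rw [mul_sub]
  have h2 : Integrable fun x => u x * ψ (x - z) := by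
    simpa [sub_eq_add_neg] using (hψ.comp_add (-z)).integrable_mul hu
  rw [integral_sub h2 (hψ.integrable_mul hu)]
  simpa [sub_eq_add_neg] using hmv

/-- Difference quotients of `u` converge weakly to its distributional derivative. -/
lemma tendsto_integral_diffQuot_mul {u ψ : E n → ℝ} (hu : Integrable u) (hψ : IsTestFun ψ)
    (v : E n) {t : ℕ → ℝ} (ht : Tendsto t atTop (𝓝[≠] 0)) :
    Tendsto (fun k => ∫ x, (t k)⁻¹ * (u (x + (-t k) • v) - u x) * ψ x) atTop
      (𝓝 (∫ x, u x * fderiv ℝ ψ x v)) := by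
  have h := (hasDerivAt_iff_tendsto_slope_zero.1
    (hasDerivAt_integral_mul_translate hu hψ v 0)).comp ht
  simp only [zero_smul, add_zero, zero_add] at h
  refine h.congr fun k => ?_
  simp only [Function.comp, smul_eq_mul]
  simp_rw [mul_assoc]
  rw [integral_const_mul, integral_translate_sub_mul hu hψ]
  simp_rw [mul_sub]
  rw [integral_sub _ (hψ.integrable_mul hu)]
  · simp [mul_sub]
  · simpa [sub_eq_add_neg] using (hψ.comp_add (t k • v)).integrable_mul hu

/-! ### Singular integral operators of order less than one -/

/-- The kernel `|z|^{-n-β}` of the fractional Laplacian. -/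
noncomputable def lapKernel (n : ℕ) (β : ℝ) (z : E n) : ℝ := (‖z‖ ^ ((n : ℝ) + β))⁻¹

/-- The `i`-th component `zᵢ |z|^{-n-α-1}` of the kernel of the fractional divergence. -/
noncomputable def gradKernel (α : ℝ) (i : Fin n) (z : E n) : ℝ :=
  z i * (‖z‖ ^ ((n : ℝ) + α + 1))⁻¹

/-- Measurable kernels dominated by `|z|^{-n-β}`. -/
structure IsSingularKernel (β : ℝ) (K : E n → ℝ) : Prop where
  measurable : Measurable K
  abs_le : ∀ z, |K z| ≤ lapKernel n β z

lemma lapKernel_nonneg (β : ℝ) (z : E n) : 0 ≤ lapKernel n β z := by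
  unfold lapKernel; positivity

lemma isSingularKernel_lapKernel (β : ℝ) : IsSingularKernel β (lapKernel n β) where
  measurable := by unfold lapKernel; fun_prop
  abs_le z := (abs_of_nonneg (lapKernel_nonneg β z)).le

lemma isSingularKernel_gradKernel (α : ℝ) (i : Fin n) :
    IsSingularKernel α (gradKernel (n := n) α i) where
  measurable := by unfold gradKernel; fun_prop
  abs_le z := by
    rcases eq_or_ne z 0 with rfl | hz
    · simpa [gradKernel] using lapKernel_nonneg α (0 : E n)
    have hz' : 0 < ‖z‖ := norm_pos_iff.2 hz
    unfold gradKernel lapKernel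
    rw [Real.rpow_add_one hz'.ne', abs_mul, mul_inv_rev,
      abs_of_pos (show 0 < ‖z‖⁻¹ * (‖z‖ ^ ((n : ℝ) + α))⁻¹ by positivity), ← mul_assoc]
    refine mul_le_of_le_one_left (by positivity) ?_
    rw [← div_eq_mul_inv, div_le_one hz']
    simpa using PiLp.norm_apply_le z i

/-- The singularity of the kernel is compensated by one order of regularity at the origin. -/
lemma integrable_min_mul_lapKernel (hn : 1 ≤ n) {β : ℝ} (hβ0 : 0 < β) (hβ1 : β < 1) :
    Integrable (fun z : E n => min 1 ‖z‖ * lapKernel n β z) := by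
  have : Nonempty (Fin n) := ⟨⟨0, hn⟩⟩
  have key := (integrable_fun_norm_addHaar (E := E n) volume
    (f := fun r => min 1 r * (r ^ ((n : ℝ) + β))⁻¹)).2
  refine key ?_
  have hpow : ∀ y : ℝ, 0 < y → y ^ (Module.finrank ℝ (E n) - 1) * (y ^ ((n : ℝ) + β))⁻¹ =
      y ^ (-1 - β) := by
    intro y hy
    rw [finrank_euclideanSpace_fin, ← Real.rpow_natCast, ← Real.rpow_neg hy.le,
      ← Real.rpow_add hy]
    congr 1
    push_cast [hn]; ring
  rw [← Set.Ioc_union_Ioi_eq_Ioi (zero_le_one (α := ℝ))]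
  refine IntegrableOn.union ?_ ?_
  · have h1 : IntegrableOn (fun y : ℝ => y ^ (-β)) (Set.Ioc 0 1) := by
      rw [← intervalIntegrable_iff_integrableOn_Ioc_of_le zero_le_one]
      exact intervalIntegral.intervalIntegrable_rpow' (by linarith)
    refine h1.congr_fun (fun y hy => ?_) measurableSet_Ioc
    simp only [smul_eq_mul, min_eq_right hy.2]
    rw [mul_left_comm, hpow y hy.1, mul_comm, ← Real.rpow_add_one hy.1.ne']
    congr 1; ring
  · have h1 : IntegrableOn (fun y : ℝ => y ^ (-1 - β)) (Set.Ioi 1) :=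
      integrableOn_Ioi_rpow_of_lt (by linarith) zero_lt_one
    refine h1.congr_fun (fun y hy => ?_) measurableSet_Ioi
    have hy' : (1 : ℝ) < y := hy
    simp only [smul_eq_mul, min_eq_left hy'.le, one_mul]
    rw [hpow y (zero_lt_one.trans hy')]

/-- The function `(x, z) ↦ K(z) (u(x+z) - u(x))` on the product space. -/
def levyIntegrand (K u : E n → ℝ) (p : E n × E n) : ℝ := K p.2 * (u (p.1 + p.2) - u p.1)

/-- The singular integral operator `u ↦ ∫ K(z) (u(·+z) - u) dz`. -/
noncomputable def levy (K u : E n → ℝ) (x : E n) : ℝ := ∫ z, K z * (u (x + z) - u x)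

lemma fracLaplacian_eq_levy (β : ℝ) (u : E n → ℝ) (x : E n) :
    fracLaplacian β u x = nuConst n β * levy (lapKernel n β) u x := by
  simp only [fracLaplacian, levy, lapKernel, div_eq_inv_mul]

lemma aestronglyMeasurable_levyIntegrand {K u : E n → ℝ} (hK : Measurable K)
    (hu : AEStronglyMeasurable u) :
    AEStronglyMeasurable (levyIntegrand K u) (volume.prod volume) := by
  have h1 : AEStronglyMeasurable (fun p : E n × E n => u (p.1 + p.2)) (volume.prod volume) :=
    hu.comp_quasiMeasurePreserving (quasiMeasurePreserving_add volume volume)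
  exact (hK.comp measurable_snd).aestronglyMeasurable.mul (h1.sub hu.comp_fst)

lemma IsSingularKernel.integrable_levyIntegrand {β : ℝ} {K u : E n → ℝ}
    (hK : IsSingularKernel β K) (hu : AEStronglyMeasurable u)
    (h : Integrable (levyIntegrand (lapKernel n β) u) (volume.prod volume)) :
    Integrable (levyIntegrand K u) (volume.prod volume) := by
  refine h.mono (aestronglyMeasurable_levyIntegrand hK.measurable hu)
    (Eventually.of_forall fun p => ?_)
  simp only [levyIntegrand, norm_mul]
  gcongr
  rw [Real.norm_of_nonneg (lapKernel_nonneg β _)]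
  exact hK.abs_le _

/-- An `L¹` modulus of continuity of order `min(1, |z|)` puts a function in every `W^{β,1}`. -/
lemma integrable_levyIntegrand_of_translate (hn : 1 ≤ n) {β : ℝ} (hβ0 : 0 < β) (hβ1 : β < 1)
    {u : E n → ℝ} (hu : Integrable u) {C : ℝ}
    (hC : ∀ z, ∫ x, |u (x + z) - u x| ≤ C * min 1 ‖z‖) :
    Integrable (levyIntegrand (lapKernel n β) u) (volume.prod volume) := by
  rw [integrable_prod_iff' (aestronglyMeasurable_levyIntegrand
    (isSingularKernel_lapKernel β).measurable hu.aestronglyMeasurable)]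
  refine ⟨Eventually.of_forall fun z =>
    ((hu.comp_add_right z).sub hu).const_mul (lapKernel n β z), ?_⟩
  refine ((integrable_min_mul_lapKernel hn hβ0 hβ1).const_mul C).mono' ?_ ?_
  · exact (aestronglyMeasurable_levyIntegrand (isSingularKernel_lapKernel β).measurable
      hu.aestronglyMeasurable).norm.prod_swap.integral_prod_right'
  · refine Eventually.of_forall fun z => ?_
    simp only [levyIntegrand, norm_mul, Real.norm_eq_abs]
    rw [abs_of_nonneg (by positivity), integral_const_mul,
      abs_of_nonneg (lapKernel_nonneg β z)]
    nlinarith [hC z, lapKernel_nonneg β z]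

lemma IsTestFun.exists_translate_bound {ψ : E n → ℝ} (hψ : IsTestFun ψ) :
    ∃ C, 0 ≤ C ∧ ∀ x z, |ψ (x + z) - ψ x| ≤ C * min 1 ‖z‖ := by
  obtain ⟨A, hA0, hA⟩ := hψ.exists_bound
  obtain ⟨L, hL0, hL⟩ := hψ.exists_fderiv_bound
  refine ⟨2 * A + L, by positivity, fun x z => ?_⟩
  have h1 : |ψ (x + z) - ψ x| ≤ L * ‖z‖ := by
    have := Convex.norm_image_sub_le_of_norm_fderiv_le (𝕜 := ℝ) (f := ψ) (s := Set.univ)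
      (fun y _ => hψ.differentiable y) (fun y _ => hL y) convex_univ
      (Set.mem_univ x) (Set.mem_univ (x + z))
    simpa using this
  have h2 : |ψ (x + z) - ψ x| ≤ 2 * A := by
    have := abs_sub (ψ (x + z)) (ψ x)
    linarith [hA x, hA (x + z)]
  rcases le_total 1 ‖z‖ with h | h
  · rw [min_eq_left h]; linarith
  · rw [min_eq_right h]; nlinarith [norm_nonneg z]

lemma integral_abs_translate_sub_le_two_mul {u : E n → ℝ} (hu : Integrable u) (z : E n) :
    ∫ x, |u (x + z) - u x| ≤ 2 * ∫ x, |u x| := by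
  calc ∫ x, |u (x + z) - u x| ≤ ∫ x, (|u (x + z)| + |u x|) :=
        integral_mono ((hu.comp_add_right z).sub hu).abs
          ((hu.comp_add_right z).abs.add hu.abs) fun x => abs_sub _ _
    _ = 2 * ∫ x, |u x| := by
        rw [integral_add (hu.comp_add_right z).abs hu.abs,
          integral_add_right_eq_self (fun x => |u x|) z]
        ring

/-- Smooth functions with compact support satisfy the `L¹` translation estimate. -/
lemma IsTestFun.exists_integral_translate_bound {ψ : E n → ℝ} (hψ : IsTestFun ψ) :
    ∃ C, ∀ z, ∫ x, |ψ (x + z) - ψ x| ≤ C * min 1 ‖z‖ := by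
  obtain ⟨C, hC0, hC⟩ := hψ.exists_translate_bound
  set S := Metric.cthickening 1 (tsupport ψ)
  have hS : volume S < ⊤ := hψ.2.isCompact.cthickening.measure_lt_top
  have hSm : MeasurableSet S := Metric.isClosed_cthickening.measurableSet
  refine ⟨2 * (∫ x, |ψ x|) + C * volume.real S, fun z => ?_⟩
  have hI0 : 0 ≤ ∫ x, |ψ x| := by positivity
  rcases le_total 1 ‖z‖ with h | h
  · rw [min_eq_left h, mul_one]
    have := integral_abs_translate_sub_le_two_mul hψ.integrable z
    have : 0 ≤ C * volume.real S := by positivity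
    linarith
  · have h1 : ∫ x, |ψ (x + z) - ψ x| ≤ ∫ x, S.indicator (fun _ => C * min 1 ‖z‖) x := by
      refine integral_mono ((hψ.integrable.comp_add_right z).sub hψ.integrable).abs
        ((integrable_indicator_iff hSm).2 (integrableOn_const hS.ne)) fun x => ?_
      by_cases hx : x ∈ S
      · simpa [Set.indicator_of_mem hx] using hC x z
      · have hx1 : ψ x = 0 := image_eq_zero_of_notMem_tsupport fun h' =>
          hx (Metric.self_subset_cthickening _ h')
        have hx2 : ψ (x + z) = 0 := image_eq_zero_of_notMem_tsupport fun h' =>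
          hx (Metric.mem_cthickening_of_dist_le x (x + z) 1 _ h' (by simpa using h))
        simp [Set.indicator_of_notMem hx, hx1, hx2]
    rw [integral_indicator_const _ hSm, smul_eq_mul] at h1
    refine h1.trans ?_
    have : 0 ≤ min 1 ‖z‖ := by positivity
    nlinarith

lemma IsTestFun.integrable_levyIntegrand (hn : 1 ≤ n) {β : ℝ} (hβ0 : 0 < β) (hβ1 : β < 1)
    {K ψ : E n → ℝ} (hK : IsSingularKernel β K) (hψ : IsTestFun ψ) :
    Integrable (levyIntegrand K ψ) (volume.prod volume) := by
  obtain ⟨C, hC⟩ := hψ.exists_integral_translate_bound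
  exact hK.integrable_levyIntegrand hψ.integrable.aestronglyMeasurable
    (integrable_levyIntegrand_of_translate hn hβ0 hβ1 hψ.integrable hC)

lemma integrable_levy {K u : E n → ℝ}
    (h : Integrable (levyIntegrand K u) (volume.prod volume)) : Integrable (levy K u) :=
  h.integral_prod_left

lemma integrable_fracLaplacian {β : ℝ} {u : E n → ℝ}
    (h : Integrable (levyIntegrand (lapKernel n β) u) (volume.prod volume)) :
    Integrable (fracLaplacian β u) := by
  simp_rw [funext (fracLaplacian_eq_levy β u)]
  exact (integrable_levy h).const_mul _

/-- The Gagliardo condition in the coordinates `(x, z) = (x, y - x)`. -/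
lemma mem_fracW_iff {α : ℝ} {u : E n → ℝ} :
    u ∈ fracW n α ↔
      Integrable u ∧ Integrable (levyIntegrand (lapKernel n α) u) (volume.prod volume) := by
  unfold fracW
  rw [Set.mem_ofPred_eq, memLp_one_iff_integrable]
  refine and_congr_right fun hu => ?_
  have hm := aestronglyMeasurable_levyIntegrand (isSingularKernel_lapKernel α).measurable
    hu.aestronglyMeasurable
  have h1 : ∫⁻ x : E n, ∫⁻ y : E n, ENNReal.ofReal (|u x - u y| / ‖x - y‖ ^ ((n : ℝ) + α)) =
      ∫⁻ p, ‖levyIntegrand (lapKernel n α) u p‖ₑ ∂(volume.prod volume) := by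
    rw [lintegral_prod _ hm.enorm]
    refine lintegral_congr fun x => ?_
    rw [← lintegral_add_left_eq_self _ x]
    refine lintegral_congr fun z => ?_
    rw [Real.enorm_eq_ofReal_abs, levyIntegrand, abs_mul, abs_of_nonneg (lapKernel_nonneg α _),
      abs_sub_comm, div_eq_inv_mul]
    simp [lapKernel]
  rw [h1]
  exact ⟨fun h => ⟨hm, h⟩, fun h => h.2⟩

/-- Singular integral operators act as Fourier multipliers. -/
lemma fourier_levy {K u : E n → ℝ} (hu : Integrable u)
    (h : Integrable (levyIntegrand K u) (volume.prod volume)) (ξ : E n) :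
    𝓕 (fun x => (levy K u x : ℂ)) ξ =
      𝓕 (fun x => (u x : ℂ)) ξ *
        ∫ z, (K z : ℂ) * (Complex.exp ((2 * π * ⟪z, ξ⟫ : ℝ) * Complex.I) - 1) := by
  have hexp : ∀ t : ℝ, ‖Complex.exp (t * Complex.I)‖ = 1 := Complex.norm_exp_ofReal_mul_I
  have hcont : Continuous fun x : E n => Complex.exp (((-2 * π * ⟪x, ξ⟫ : ℝ) : ℂ) * Complex.I) := by
    fun_prop
  have hint : ∀ v : E n → ℝ, Integrable v → Integrable fun x : E n =>
      Complex.exp (((-2 * π * ⟪x, ξ⟫ : ℝ) : ℂ) * Complex.I) * (v x : ℂ) := fun v hv =>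
    hv.ofReal.bdd_mul hcont.aestronglyMeasurable (Eventually.of_forall fun x => (hexp _).le)
  have h2 : Integrable (fun p : E n × E n =>
      Complex.exp (((-2 * π * ⟪p.1, ξ⟫ : ℝ) : ℂ) * Complex.I) * (levyIntegrand K u p : ℂ))
      (volume.prod volume) :=
    h.ofReal.bdd_mul (hcont.comp continuous_fst).aestronglyMeasurable
      (Eventually.of_forall fun x => (hexp _).le)
  rw [Real.fourier_eq']
  calc ∫ x, Complex.exp (((-2 * π * ⟪x, ξ⟫ : ℝ) : ℂ) * Complex.I) • (levy K u x : ℂ)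
      = ∫ x, ∫ z, Complex.exp (((-2 * π * ⟪x, ξ⟫ : ℝ) : ℂ) * Complex.I) *
          (levyIntegrand K u (x, z) : ℂ) := by
        congr 1; ext x
        rw [integral_const_mul, smul_eq_mul]
        congr 1
        exact integral_ofReal.symm
    _ = ∫ z, ∫ x, Complex.exp (((-2 * π * ⟪x, ξ⟫ : ℝ) : ℂ) * Complex.I) *
          (levyIntegrand K u (x, z) : ℂ) := integral_integral_swap h2
    _ = ∫ z, 𝓕 (fun x => (u x : ℂ)) ξ *
          ((K z : ℂ) * (Complex.exp ((2 * π * ⟪z, ξ⟫ : ℝ) * Complex.I) - 1)) := by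
        congr 1; ext z
        have e1 : ∀ x, Complex.exp (((-2 * π * ⟪x, ξ⟫ : ℝ) : ℂ) * Complex.I) *
            (levyIntegrand K u (x, z) : ℂ) =
            (K z : ℂ) * (Complex.exp (((-2 * π * ⟪x, ξ⟫ : ℝ) : ℂ) * Complex.I) * (u (x + z) : ℂ) -
              Complex.exp (((-2 * π * ⟪x, ξ⟫ : ℝ) : ℂ) * Complex.I) * (u x : ℂ)) := by
          intro x; simp only [levyIntegrand]; push_cast; ring
        simp_rw [e1]
        rw [integral_const_mul, integral_sub (hint _ (hu.comp_add_right z)) (hint _ hu)]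
        have e2 : ∫ x, Complex.exp (((-2 * π * ⟪x, ξ⟫ : ℝ) : ℂ) * Complex.I) * (u (x + z) : ℂ) =
            Complex.exp ((2 * π * ⟪z, ξ⟫ : ℝ) * Complex.I) * 𝓕 (fun x => (u x : ℂ)) ξ := by
          rw [Real.fourier_eq', ← integral_const_mul, ← integral_add_right_eq_self
            (fun x => Complex.exp ((2 * π * ⟪z, ξ⟫ : ℝ) * Complex.I) *
              (Complex.exp (((-2 * π * ⟪x, ξ⟫ : ℝ) : ℂ) * Complex.I) • (u x : ℂ))) z]
          congr 1; ext x
          rw [smul_eq_mul, ← mul_assoc, ← Complex.exp_add, inner_add_left]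
          congr 2; push_cast; ring
        have e3 : ∫ x, Complex.exp (((-2 * π * ⟪x, ξ⟫ : ℝ) : ℂ) * Complex.I) * (u x : ℂ) =
            𝓕 (fun x => (u x : ℂ)) ξ := by
          rw [Real.fourier_eq']; rfl
        rw [e2, e3]; ring
    _ = _ := integral_const_mul _ _

/-- Integration by parts for odd kernels. -/
lemma integral_mul_levy_of_odd (hn : 1 ≤ n) {β : ℝ} (hβ0 : 0 < β) (hβ1 : β < 1)
    {K f ψ : E n → ℝ} (hK : IsSingularKernel β K) (hodd : ∀ z, K (-z) = -K z)
    (hf : Integrable f) (hfK : Integrable (levyIntegrand K f) (volume.prod volume))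
    (hψ : IsTestFun ψ) :
    ∫ x, f x * levy K ψ x = -∫ x, levy K f x * ψ x := by
  obtain ⟨C, hC0, hC⟩ := hψ.exists_translate_bound
  obtain ⟨A, hA0, hA⟩ := hψ.exists_bound
  have h1 : Integrable (fun p : E n × E n => f p.1 * levyIntegrand K ψ p)
      (volume.prod volume) := by
    have hb : Integrable (fun p : E n × E n => f p.1 * (C * (min 1 ‖p.2‖ * lapKernel n β p.2)))
        (volume.prod volume) :=
      hf.mul_prod ((integrable_min_mul_lapKernel hn hβ0 hβ1).const_mul C)
    refine hb.mono (hf.aestronglyMeasurable.comp_fst.mul (aestronglyMeasurable_levyIntegrand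
      hK.measurable hψ.continuous.aestronglyMeasurable)) (Eventually.of_forall fun p => ?_)
    have h0 := lapKernel_nonneg β p.2
    rw [norm_mul, norm_mul, Real.norm_of_nonneg
      (show 0 ≤ C * (min 1 ‖p.2‖ * lapKernel n β p.2) by positivity)]
    refine mul_le_mul_of_nonneg_left ?_ (norm_nonneg _)
    calc ‖levyIntegrand K ψ p‖ = |K p.2| * |ψ (p.1 + p.2) - ψ p.1| := by
          rw [levyIntegrand, norm_mul]; rfl
      _ ≤ lapKernel n β p.2 * (C * min 1 ‖p.2‖) := by
          gcongr
          · exact hK.abs_le _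
          · exact hC _ _
      _ = _ := by ring
  have h2 : Integrable (fun p : E n × E n => levyIntegrand K f p * ψ p.1)
      (volume.prod volume) :=
    hfK.mul_bdd (hψ.continuous.comp continuous_fst).aestronglyMeasurable
      (Eventually.of_forall fun p => hA p.1)
  calc ∫ x, f x * levy K ψ x = ∫ x, ∫ z, f x * levyIntegrand K ψ (x, z) := by
        congr 1; ext x; rw [integral_const_mul]; rfl
    _ = ∫ z, ∫ x, f x * levyIntegrand K ψ (x, z) := integral_integral_swap h1
    _ = ∫ z, -∫ x, levyIntegrand K f (x, -z) * ψ x := by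
        congr 1; ext z
        have := integral_translate_sub_mul hf hψ (-z)
        simp only [levyIntegrand, hodd, mul_left_comm (f _) (K z), mul_assoc]
        rw [integral_const_mul, integral_const_mul, this]
        simp
    _ = -∫ z, ∫ x, levyIntegrand K f (x, -z) * ψ x := integral_neg _
    _ = -∫ z, ∫ x, levyIntegrand K f (x, z) * ψ x := by
        rw [integral_neg_eq_self (fun z => ∫ x, levyIntegrand K f (x, z) * ψ x)]
    _ = -∫ x, ∫ z, levyIntegrand K f (x, z) * ψ x := by
        rw [← integral_integral_swap (f := fun x z => levyIntegrand K f (x, z) * ψ x) h2]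
    _ = _ := by
        congr 2; ext x; rw [integral_mul_const]; rfl

/-! ### Subordination to Gaussians -/

/-- The character `z ↦ e^{2πi z·ξ}`. -/
noncomputable def character (ξ z : E n) : ℂ := Complex.exp ((2 * π * ⟪z, ξ⟫ : ℝ) * Complex.I)

lemma norm_character (ξ z : E n) : ‖character ξ z‖ = 1 := Complex.norm_exp_ofReal_mul_I _

lemma continuous_character (ξ : E n) : Continuous (character ξ) := by
  unfold character; fun_prop

lemma norm_character_sub_one_le (ξ z : E n) :
    ‖character ξ z - 1‖ ≤ (2 + 2 * π * ‖ξ‖) * min 1 ‖z‖ := by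
  have h1 : ‖character ξ z - 1‖ ≤ 2 := by
    refine (norm_sub_le _ _).trans ?_
    rw [norm_character, norm_one]; norm_num
  have h2 : ‖character ξ z - 1‖ ≤ 2 * π * ‖ξ‖ * ‖z‖ := by
    rw [character, mul_comm _ Complex.I]
    refine (Real.norm_exp_I_mul_ofReal_sub_one_le).trans ?_
    rw [Real.norm_eq_abs, abs_mul, abs_of_pos (by positivity : 0 < 2 * π), mul_assoc (2 * π)]
    gcongr
    rw [mul_comm]
    exact abs_real_inner_le_norm z ξ
  have hp : 0 ≤ 2 * π * ‖ξ‖ := by positivity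
  rcases le_total 1 ‖z‖ with h | h
  · rw [min_eq_left h]; linarith
  · rw [min_eq_right h]; nlinarith [norm_nonneg z]

lemma hasFDerivAt_character (ξ z : E n) (v : E n) :
    DifferentiableAt ℝ (character ξ) z ∧
      fderiv ℝ (character ξ) z v = (2 * π * ⟪v, ξ⟫ : ℝ) * Complex.I * character ξ z := by
  have h1 : HasFDerivAt (fun z : E n => 2 * π * ⟪z, ξ⟫) ((2 * π) • innerSL ℝ ξ) z := by
    have h0 : HasFDerivAt (fun z : E n => ⟪ξ, z⟫) (innerSL ℝ ξ) z := (innerSL ℝ ξ).hasFDerivAt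
    simpa [real_inner_comm] using h0.const_mul (2 * π)
  have h2 := ((Complex.ofRealCLM.hasFDerivAt.comp z h1).mul_const Complex.I).cexp
  have h3 : HasFDerivAt (character ξ) _ z := h2
  refine ⟨h3.differentiableAt, ?_⟩
  rw [h3.fderiv]
  simp [character, real_inner_comm]
  ring

lemma integrable_norm_mul_gaussian (hn : 1 ≤ n) {s : ℝ} (hs : 0 < s) :
    Integrable fun z : E n => ‖z‖ * Real.exp (-s * ‖z‖ ^ 2) := by
  have : Nonempty (Fin n) := ⟨⟨0, hn⟩⟩
  refine (integrable_fun_norm_addHaar (E := E n) volume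
    (f := fun r => r * Real.exp (-s * r ^ 2))).2 ?_
  refine (integrableOn_rpow_mul_exp_neg_mul_sq hs (s := (n : ℝ))
    (by linarith [n.cast_nonneg (α := ℝ)])).congr_fun (fun y hy => ?_) measurableSet_Ioi
  simp only [smul_eq_mul, finrank_euclideanSpace_fin, Real.rpow_natCast]
  rw [← mul_assoc, ← pow_succ, Nat.sub_add_cancel hn]

lemma integrable_coord_mul_gaussian (hn : 1 ≤ n) {s : ℝ} (hs : 0 < s) (i : Fin n) :
    Integrable fun z : E n => z i * Real.exp (-s * ‖z‖ ^ 2) := by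
  refine (integrable_norm_mul_gaussian hn hs).mono
    (Continuous.aestronglyMeasurable (by fun_prop)) (Eventually.of_forall fun z => ?_)
  rw [norm_mul, norm_mul, norm_norm]
  gcongr
  exact PiLp.norm_apply_le z i

lemma integrable_gaussian {s : ℝ} (hs : 0 < s) :
    Integrable fun z : E n => Real.exp (-s * ‖z‖ ^ 2) := by
  have := GaussianFourier.integrable_cexp_neg_mul_sq_norm_add (V := E n) (b := (s : ℂ))
    (by simpa) 0 0
  refine this.re.congr (Eventually.of_forall fun z => ?_)
  have : (-(s : ℂ) * ‖z‖ ^ 2 + 0 * (⟪(0 : E n), z⟫ : ℝ)) = ((-s * ‖z‖ ^ 2 : ℝ) : ℂ) := by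
    push_cast; ring
  change (Complex.exp _).re = _
  rw [this, ← Complex.ofReal_exp, Complex.ofReal_re]

lemma integral_gaussian_mul_character {s : ℝ} (hs : 0 < s) (ξ : E n) :
    ∫ z : E n, (Real.exp (-s * ‖z‖ ^ 2) : ℂ) * character ξ z =
      (((π / s) ^ ((n : ℝ) / 2) * Real.exp (-(π ^ 2 * ‖ξ‖ ^ 2) / s) : ℝ) : ℂ) := by
  have h := GaussianFourier.integral_cexp_neg_mul_sq_norm_add (V := E n) (b := (s : ℂ))
    (by simpa) (2 * π * Complex.I) ξ
  have e1 : ∀ z : E n, (Real.exp (-s * ‖z‖ ^ 2) : ℂ) * character ξ z =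
      Complex.exp (-(s : ℂ) * ‖z‖ ^ 2 + 2 * π * Complex.I * (⟪ξ, z⟫ : ℝ)) := by
    intro z
    rw [character, Complex.ofReal_exp, ← Complex.exp_add, real_inner_comm]
    congr 1; push_cast; ring
  simp_rw [e1]
  rw [h, finrank_euclideanSpace_fin, Complex.ofReal_mul, Complex.ofReal_cpow (by positivity),
    Complex.ofReal_exp]
  congr 2
  · push_cast; rfl
  · push_cast; rfl
  · push_cast
    have : (s : ℂ) ≠ 0 := by exact_mod_cast hs.ne'
    field_simp
    rw [Complex.I_sq]; ring

/-- The first moment of a Gaussian against a character, by integrating the derivative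
`∂ᵢ e^{-s|z|²} = -2s zᵢ e^{-s|z|²}` by parts. -/
lemma integral_coord_mul_gaussian_mul_character (hn : 1 ≤ n) {s : ℝ} (hs : 0 < s) (ξ : E n)
    (i : Fin n) :
    ∫ z : E n, ((z i * Real.exp (-s * ‖z‖ ^ 2) : ℝ) : ℂ) * character ξ z =
      (π * ξ i / s : ℝ) * Complex.I *
      (((π / s) ^ ((n : ℝ) / 2) * Real.exp (-(π ^ 2 * ‖ξ‖ ^ 2) / s) : ℝ) : ℂ) := by
  set v : E n := EuclideanSpace.single i (1 : ℝ)
  set G : E n → ℂ := fun z => (Real.exp (-s * ‖z‖ ^ 2) : ℂ)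
  have hG : ∀ z, HasFDerivAt G (Complex.ofRealCLM.comp
      ((Real.exp (-s * ‖z‖ ^ 2)) • (-s) • (2 • innerSL ℝ z))) z := fun z =>
    Complex.ofRealCLM.hasFDerivAt.comp z
      (((hasStrictFDerivAt_norm_sq z).hasFDerivAt.const_mul (-s)).exp)
  have hGv : ∀ z, fderiv ℝ G z v = -(2 * s : ℝ) * ((z i * Real.exp (-s * ‖z‖ ^ 2) : ℝ) : ℂ) := by
    intro z
    rw [(hG z).fderiv]
    simp [v, EuclideanSpace.inner_single_right]
    ring
  have hint1 : Integrable fun z : E n => ((z i * Real.exp (-s * ‖z‖ ^ 2) : ℝ) : ℂ) :=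
    (integrable_coord_mul_gaussian hn hs i).ofReal
  have hint2 : Integrable G := (integrable_gaussian hs).ofReal
  have hbdd : ∀ {F : E n → ℂ}, Integrable F → Integrable fun z => character ξ z * F z := fun hF =>
    hF.bdd_mul (continuous_character ξ).aestronglyMeasurable
      (Eventually.of_forall fun z => (norm_character ξ z).le)
  have hparts := integral_mul_fderiv_eq_neg_fderiv_mul_of_integrable (μ := volume) (𝕜 := ℂ)
    (f := character ξ) (g := G) (v := v) ?_ ?_ (hbdd hint2)
    (fun z _ => (hasFDerivAt_character ξ z v).1) (fun z _ => (hG z).differentiableAt)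
  · simp_rw [hGv, (hasFDerivAt_character ξ _ v).2] at hparts
    have e1 : ∀ z : E n, character ξ z * (-(2 * s : ℝ) * ((z i * Real.exp (-s * ‖z‖ ^ 2) : ℝ) : ℂ)) =
      -(2 * s : ℝ) * (((z i * Real.exp (-s * ‖z‖ ^ 2) : ℝ) : ℂ) * character ξ z) := fun z => by ring
    have e2 : ∀ z : E n, (2 * π * ⟪v, ξ⟫ : ℝ) * Complex.I * character ξ z * G z =
      ((2 * π * ξ i : ℝ) * Complex.I) * ((Real.exp (-s * ‖z‖ ^ 2) : ℂ) * character ξ z) := fun z => by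
        simp [v, EuclideanSpace.inner_single_left, G]; ring
    simp_rw [e1, e2] at hparts
    rw [integral_const_mul, integral_const_mul, integral_gaussian_mul_character hs] at hparts
    have hs' : (s : ℂ) ≠ 0 := by exact_mod_cast hs.ne'
    have h2s : (-(2 * s : ℝ) : ℂ) ≠ 0 := by
      push_cast; exact neg_ne_zero.2 (mul_ne_zero two_ne_zero hs')
    apply mul_left_cancel₀ h2s
    rw [hparts]
    push_cast
    field_simp
  · simp_rw [(hasFDerivAt_character ξ _ v).2, mul_assoc]
    exact ((hbdd hint2).const_mul _).const_mul _
  · simp_rw [hGv]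
    exact hbdd (hint1.const_mul _)

/-- Subordination of a singular kernel to Gaussians: the symbol of `P(z) |z|^{-2a}` is a
superposition of integrals against `e^{-s|z|²}`. -/
lemma gaussian_subordination (hn : 1 ≤ n) {β a : ℝ} (hβ0 : 0 < β) (hβ1 : β < 1) (ha : 0 < a)
    {P : E n → ℝ} (hP : Measurable P)
    (hK : IsSingularKernel β (fun z : E n => P z * (‖z‖ ^ (2 * a))⁻¹)) (ξ : E n) :
    (Real.Gamma a : ℂ) * ∫ z : E n, ((P z * (‖z‖ ^ (2 * a))⁻¹ : ℝ) : ℂ) * (character ξ z - 1) =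
      ∫ s in Ioi (0 : ℝ), ((s ^ (a - 1) : ℝ) : ℂ) *
        ∫ z : E n, ((P z * Real.exp (-s * ‖z‖ ^ 2) : ℝ) : ℂ) * (character ξ z - 1) := by
  have : Nonempty (Fin n) := ⟨⟨0, hn⟩⟩
  have hgam : ∀ z : E n, z ≠ 0 →
      ∫ s in Ioi (0 : ℝ), s ^ (a - 1) * Real.exp (-s * ‖z‖ ^ 2) =
        Real.Gamma a * (‖z‖ ^ (2 * a))⁻¹ := by
    intro z hz
    have hz' : 0 < ‖z‖ := norm_pos_iff.2 hz
    have := Real.integral_rpow_mul_exp_neg_mul_Ioi ha (r := ‖z‖ ^ 2) (by positivity)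
    simp_rw [neg_mul, mul_comm _ (‖z‖ ^ 2)]
    rw [this, one_div, Real.inv_rpow (by positivity), ← Real.rpow_natCast, ← Real.rpow_mul hz'.le,
      mul_comm]
    norm_num
  have hgami : ∀ z : E n, z ≠ 0 →
      IntegrableOn (fun s : ℝ => s ^ (a - 1) * Real.exp (-s * ‖z‖ ^ 2)) (Ioi 0) := by
    intro z hz
    have hz' : 0 < ‖z‖ := norm_pos_iff.2 hz
    refine Integrable.of_integral_ne_zero (f := fun s : ℝ => s ^ (a - 1) * Real.exp (-s * ‖z‖ ^ 2))
      (μ := volume.restrict (Ioi 0)) ?_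
    rw [hgam z hz]
    have := Real.Gamma_pos_of_pos ha
    positivity
  have hne : ∀ᵐ z : E n, z ≠ 0 := by
    simp [ae_iff]
  set F : E n → ℝ → ℂ := fun z s =>
    ((s ^ (a - 1) * Real.exp (-s * ‖z‖ ^ 2) : ℝ) : ℂ) * (P z * (character ξ z - 1))
  have hFm : AEStronglyMeasurable (Function.uncurry F)
      ((volume : Measure (E n)).prod (volume.restrict (Ioi (0 : ℝ)))) := by
    have h1 : Measurable fun p : E n × ℝ => character ξ p.1 :=
      (continuous_character ξ).measurable.comp measurable_fst
    have h2 : Measurable fun p : E n × ℝ => P p.1 := hP.comp measurable_fst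
    refine Measurable.aestronglyMeasurable ?_
    simp only [F, Function.uncurry_def]
    fun_prop
  have hFi : Integrable (Function.uncurry F)
      ((volume : Measure (E n)).prod (volume.restrict (Ioi (0 : ℝ)))) := by
    rw [integrable_prod_iff hFm]
    constructor
    · filter_upwards [hne] with z hz
      exact (Integrable.ofReal (𝕜 := ℂ) (hgami z hz)).mul_const
        ((P z : ℂ) * (character ξ z - 1))
    · refine (((integrable_min_mul_lapKernel hn hβ0 hβ1).const_mul
        (Real.Gamma a * (2 + 2 * π * ‖ξ‖)))).mono' hFm.norm.integral_prod_right' ?_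
      filter_upwards [hne] with z hz
      have e1 : ∫ s in Ioi (0 : ℝ), ‖Function.uncurry F (z, s)‖ =
          Real.Gamma a * (|P z * (‖z‖ ^ (2 * a))⁻¹| * ‖character ξ z - 1‖) := by
        have e2 : ∀ s ∈ Ioi (0 : ℝ), ‖Function.uncurry F (z, s)‖ =
            s ^ (a - 1) * Real.exp (-s * ‖z‖ ^ 2) * (|P z| * ‖character ξ z - 1‖) := by
          intro s hs
          have hs' : 0 < s := hs
          simp only [Function.uncurry, F]
          rw [norm_mul, norm_mul, Complex.norm_real, Complex.norm_real, Real.norm_of_nonneg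
            (by positivity : 0 ≤ s ^ (a - 1) * Real.exp (-s * ‖z‖ ^ 2)), Real.norm_eq_abs]
        rw [setIntegral_congr_fun measurableSet_Ioi e2, integral_mul_const, hgam z hz, abs_mul,
          abs_of_nonneg (by positivity : 0 ≤ (‖z‖ ^ (2 * a))⁻¹)]
        ring
      rw [e1, Real.norm_of_nonneg (mul_nonneg (Real.Gamma_pos_of_pos ha).le (by positivity)),
        mul_assoc]
      have hG := (Real.Gamma_pos_of_pos ha).le
      refine mul_le_mul_of_nonneg_left ?_ hG
      calc |P z * (‖z‖ ^ (2 * a))⁻¹| * ‖character ξ z - 1‖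
          ≤ lapKernel n β z * ((2 + 2 * π * ‖ξ‖) * min 1 ‖z‖) := by
            gcongr
            · exact lapKernel_nonneg β z
            · exact hK.abs_le z
            · exact norm_character_sub_one_le ξ z
        _ = _ := by ring
  calc _ = ∫ z : E n, ∫ s in Ioi (0 : ℝ), F z s := by
        rw [← integral_const_mul]
        refine integral_congr_ae ?_
        filter_upwards [hne] with z hz
        simp only [F]
        rw [integral_mul_const, integral_complex_ofReal, hgam z hz]
        push_cast; ring
    _ = ∫ s in Ioi (0 : ℝ), ∫ z : E n, F z s := integral_integral_swap hFi
    _ = _ := by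
        congr 1; ext s
        rw [← integral_const_mul]
        congr 1; ext z
        simp only [F]; push_cast; ring

/-! ### The Fourier symbols -/

lemma integral_comp_inv_Ioi (g : ℝ → ℝ) :
    ∫ s in Ioi (0 : ℝ), g s⁻¹ = ∫ r in Ioi (0 : ℝ), r ^ (-2 : ℝ) * g r := by
  rw [← integral_comp_rpow_Ioi (fun r : ℝ => r ^ (-2 : ℝ) * g r) (p := -1) (by norm_num)]
  refine setIntegral_congr_fun measurableSet_Ioi fun s hs => ?_
  have hs' : 0 < s := hs
  simp only [smul_eq_mul, Real.rpow_neg_one, abs_neg, abs_one, one_mul]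
  rw [← mul_assoc, Real.inv_rpow hs'.le, ← Real.rpow_neg hs'.le, ← Real.rpow_add hs']
  norm_num

/-- The `s`-integral in the symbol of the fractional gradient, by the substitution `r = 1/s`. -/
lemma integral_rpow_mul_exp_neg_div {b c : ℝ} (hb : 0 < b) (hc : 0 < c) :
    ∫ s in Ioi (0 : ℝ), s ^ (-b - 1) * Real.exp (-c / s) = c ^ (-b) * Real.Gamma b := by
  have h := integral_comp_inv_Ioi (fun r => r ^ (b + 1) * Real.exp (-(c * r)))
  have e1 : ∀ s ∈ Ioi (0 : ℝ), s ^ (-b - 1) * Real.exp (-c / s) =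
      s⁻¹ ^ (b + 1) * Real.exp (-(c * s⁻¹)) := by
    intro s hs
    have hs' : 0 < s := hs
    rw [Real.inv_rpow hs'.le, ← Real.rpow_neg hs'.le]
    congr 2 <;> ring
  rw [setIntegral_congr_fun measurableSet_Ioi e1, h]
  have e2 : ∀ r ∈ Ioi (0 : ℝ), r ^ (-2 : ℝ) * (r ^ (b + 1) * Real.exp (-(c * r))) =
      r ^ (b - 1) * Real.exp (-(c * r)) := by
    intro r hr
    have hr' : 0 < r := hr
    rw [← mul_assoc, ← Real.rpow_add hr']
    congr 2; ring
  rw [setIntegral_congr_fun measurableSet_Ioi e2, Real.integral_rpow_mul_exp_neg_mul_Ioi hb hc,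
    one_div, Real.inv_rpow hc.le, Real.rpow_neg hc.le]

lemma one_sub_exp_neg_le {t : ℝ} : 1 - Real.exp (-t) ≤ t := by
  linarith [Real.add_one_le_exp (-t)]

/-- The Gamma integral continued to the strip `-1 < -b < 0`. -/
lemma integral_rpow_mul_exp_neg_sub_one {b c : ℝ} (hb0 : 0 < b) (hb1 : b < 1) (hc : 0 < c) :
    ∫ r in Ioi (0 : ℝ), r ^ (-b - 1) * (Real.exp (-(c * r)) - 1) = c ^ b * Real.Gamma (-b) := by
  have hI1 : IntegrableOn (fun r : ℝ => r ^ (-b - 1) * (Real.exp (-(c * r)) - 1)) (Ioi 0) := by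
    have hm : Measurable (fun r : ℝ => r ^ (-b - 1) * (Real.exp (-(c * r)) - 1)) := by fun_prop
    rw [← Ioc_union_Ioi_eq_Ioi (zero_le_one (α := ℝ))]
    refine IntegrableOn.union ?_ ?_
    · have h1 : IntegrableOn (fun y : ℝ => c * y ^ (-b)) (Ioc 0 1) := by
        rw [← intervalIntegrable_iff_integrableOn_Ioc_of_le zero_le_one]
        exact (intervalIntegral.intervalIntegrable_rpow' (by linarith)).const_mul c
      refine Integrable.mono' h1 hm.aestronglyMeasurable
        ((ae_restrict_iff' measurableSet_Ioc).2 (Eventually.of_forall fun r hr => ?_))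
      have hcr : 0 < c * r := mul_pos hc hr.1
      have hexp : Real.exp (-(c * r)) ≤ 1 := Real.exp_le_one_iff.2 (by linarith)
      rw [norm_mul, Real.norm_of_nonneg (Real.rpow_nonneg hr.1.le _), Real.norm_eq_abs,
        abs_of_nonpos (by linarith)]
      have := one_sub_exp_neg_le (t := c * r)
      calc r ^ (-b - 1) * -(Real.exp (-(c * r)) - 1) ≤ r ^ (-b - 1) * (c * r) := by
            gcongr
            · exact Real.rpow_nonneg hr.1.le _
            · linarith
        _ = c * (r ^ (-b - 1) * r) := by ring
        _ = c * r ^ (-b) := by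
            rw [← Real.rpow_add_one hr.1.ne']; congr 2; ring
    · have h1 : IntegrableOn (fun y : ℝ => y ^ (-b - 1)) (Ioi 1) :=
        integrableOn_Ioi_rpow_of_lt (by linarith) zero_lt_one
      refine Integrable.mono' h1 hm.aestronglyMeasurable
        ((ae_restrict_iff' measurableSet_Ioi).2 (Eventually.of_forall fun r hr => ?_))
      have hr0 : 0 < r := zero_lt_one.trans hr
      have hcr : 0 < c * r := mul_pos hc hr0
      have hexp : Real.exp (-(c * r)) ≤ 1 := Real.exp_le_one_iff.2 (by linarith)
      rw [norm_mul, Real.norm_of_nonneg (Real.rpow_nonneg hr0.le _), Real.norm_eq_abs,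
        abs_of_nonpos (by linarith)]
      exact mul_le_of_le_one_right (Real.rpow_nonneg hr0.le _)
        (by linarith [Real.exp_pos (-(c * r))])
  have hG := Real.integral_rpow_mul_exp_neg_mul_Ioi (a := 1 - b) (by linarith) hc
  have hGpos := Real.Gamma_pos_of_pos (s := 1 - b) (by linarith)
  have hI2 : IntegrableOn (fun r : ℝ => r ^ (1 - b - 1) * Real.exp (-(c * r))) (Ioi 0) := by
    refine Integrable.of_integral_ne_zero (f := fun r : ℝ => r ^ (1 - b - 1) * Real.exp (-(c * r)))
      (μ := volume.restrict (Ioi 0)) ?_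
    rw [hG]; positivity
  -- integrate by parts with the primitive `r ^ (-b) * (e^{-cr} - 1)`
  have hder : ∀ r ∈ Ioi (0 : ℝ), HasDerivAt (fun r : ℝ => r ^ (-b) * (Real.exp (-(c * r)) - 1))
      ((-b) * (r ^ (-b - 1) * (Real.exp (-(c * r)) - 1)) +
        (-c) * (r ^ (1 - b - 1) * Real.exp (-(c * r)))) r := by
    intro r hr
    have hr' : 0 < r := hr
    have h1 := Real.hasDerivAt_rpow_const (x := r) (p := -b) (Or.inl hr'.ne')
    have h2 : HasDerivAt (fun r : ℝ => Real.exp (-(c * r)) - 1) (Real.exp (-(c * r)) * -c) r := by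
      have h3 : HasDerivAt (fun r : ℝ => -(c * r)) (-c) r := by
        simpa using ((hasDerivAt_id' r).const_mul c).fun_neg
      exact h3.exp.sub_const 1
    convert! h1.mul h2 using 1
    rw [show 1 - b - 1 = -b by ring]; ring
  have hcont : ContinuousWithinAt (fun r : ℝ => r ^ (-b) * (Real.exp (-(c * r)) - 1)) (Ici 0) 0 := by
    rw [ContinuousWithinAt]
    simp only [mul_zero, neg_zero, Real.exp_zero, sub_self]
    have hlim : Tendsto (fun r : ℝ => c * r ^ (1 - b)) (𝓝[≥] 0) (𝓝 0) := by
      have : ContinuousAt (fun r : ℝ => c * r ^ (1 - b)) 0 :=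
        (Real.continuousAt_rpow_const 0 (1 - b) (Or.inr (by linarith))).const_mul c
      have h := this.tendsto
      rw [Real.zero_rpow (by linarith), mul_zero] at h
      exact h.mono_left nhdsWithin_le_nhds
    refine squeeze_zero_norm' ?_ hlim
    filter_upwards [self_mem_nhdsWithin] with r hr
    rcases (show (0 : ℝ) ≤ r from hr).eq_or_lt with rfl | hr0
    · simp [Real.zero_rpow (show 1 - b ≠ 0 by linarith)]
    have hcr : 0 < c * r := mul_pos hc hr0
    have hexp : Real.exp (-(c * r)) ≤ 1 := Real.exp_le_one_iff.2 (by linarith)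
    rw [norm_mul, Real.norm_of_nonneg (Real.rpow_nonneg hr0.le _), Real.norm_eq_abs,
      abs_of_nonpos (by linarith)]
    have := one_sub_exp_neg_le (t := c * r)
    calc r ^ (-b) * -(Real.exp (-(c * r)) - 1) ≤ r ^ (-b) * (c * r) := by
          gcongr
          linarith
      _ = c * (r ^ (-b) * r) := by ring
      _ = c * r ^ (1 - b) := by
          rw [← Real.rpow_add_one hr0.ne']; congr 2; ring
  have htop : Tendsto (fun r : ℝ => r ^ (-b) * (Real.exp (-(c * r)) - 1)) atTop (𝓝 0) := by
    refine squeeze_zero_norm' ?_ (tendsto_rpow_neg_atTop hb0)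
    filter_upwards [eventually_gt_atTop 0] with r hr0
    have hcr : 0 < c * r := mul_pos hc hr0
    have hexp : Real.exp (-(c * r)) ≤ 1 := Real.exp_le_one_iff.2 (by linarith)
    rw [norm_mul, Real.norm_of_nonneg (Real.rpow_nonneg hr0.le _), Real.norm_eq_abs,
      abs_of_nonpos (by linarith)]
    exact mul_le_of_le_one_right (Real.rpow_nonneg hr0.le _)
      (by linarith [Real.exp_pos (-(c * r))])
  have key := integral_Ioi_of_hasDerivAt_of_tendsto hcont hder
    ((hI1.const_mul (-b)).add (hI2.const_mul (-c))) htop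
  rw [integral_add (hI1.const_mul (-b)) (hI2.const_mul (-c)), integral_const_mul,
    integral_const_mul, hG] at key
  simp only [mul_zero, neg_zero, Real.exp_zero, sub_self] at key
  have hGam := Real.Gamma_add_one (s := -b) (by linarith)
  rw [show -b + 1 = 1 - b by ring] at hGam
  rw [hGam, one_div, Real.inv_rpow hc.le, ← Real.rpow_neg hc.le] at key
  have hcb : c * c ^ (-(1 - b)) = c ^ b := by
    rw [mul_comm, ← Real.rpow_add_one hc.ne']; congr 1; ring
  have hfin : b * (∫ r in Ioi (0 : ℝ), r ^ (-b - 1) * (Real.exp (-(c * r)) - 1)) =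
      b * (c ^ b * Real.Gamma (-b)) := by
    rw [← hcb]; linarith
  exact mul_left_cancel₀ hb0.ne' hfin

/-- The `s`-integral in the symbol of the fractional Laplacian, by the substitution `r = 1/s`. -/
lemma integral_rpow_mul_exp_neg_div_sub_one {b c : ℝ} (hb0 : 0 < b) (hb1 : b < 1) (hc : 0 ≤ c) :
    ∫ s in Ioi (0 : ℝ), s ^ (b - 1) * (Real.exp (-c / s) - 1) = c ^ b * Real.Gamma (-b) := by
  rcases hc.eq_or_lt with rfl | hc
  · simp [Real.zero_rpow hb0.ne']
  have h := integral_comp_inv_Ioi (fun r => r ^ (1 - b) * (Real.exp (-(c * r)) - 1))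
  have e1 : ∀ s ∈ Ioi (0 : ℝ), s ^ (b - 1) * (Real.exp (-c / s) - 1) =
      s⁻¹ ^ (1 - b) * (Real.exp (-(c * s⁻¹)) - 1) := by
    intro s hs
    have hs' : 0 < s := hs
    rw [Real.inv_rpow hs'.le, ← Real.rpow_neg hs'.le]
    congr 3 <;> ring
  rw [setIntegral_congr_fun measurableSet_Ioi e1, h]
  have e2 : ∀ r ∈ Ioi (0 : ℝ), r ^ (-2 : ℝ) * (r ^ (1 - b) * (Real.exp (-(c * r)) - 1)) =
      r ^ (-b - 1) * (Real.exp (-(c * r)) - 1) := by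
    intro r hr
    have hr' : 0 < r := hr
    rw [← mul_assoc, ← Real.rpow_add hr']
    congr 2; ring
  rw [setIntegral_congr_fun measurableSet_Ioi e2, integral_rpow_mul_exp_neg_sub_one hb0 hb1 hc]

/-- The symbol of the fractional Laplacian. -/
lemma nuConst_mul_symbol (hn : 1 ≤ n) {β : ℝ} (hβ0 : 0 < β) (hβ1 : β < 1) (ξ : E n) :
    (nuConst n β : ℂ) * ∫ z, (lapKernel n β z : ℂ) * (character ξ z - 1) =
      ((2 * π * ‖ξ‖) ^ β : ℝ) := by
  have hn0 : (0 : ℝ) < n := by exact_mod_cast hn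
  set a : ℝ := ((n : ℝ) + β) / 2
  have ha : 0 < a := by positivity
  have hK : IsSingularKernel β (fun z : E n => 1 * (‖z‖ ^ (2 * a))⁻¹) := by
    have : (fun z : E n => 1 * (‖z‖ ^ (2 * a))⁻¹) = lapKernel n β := by
      ext z; simp only [lapKernel, one_mul, a]; congr 2; ring
    rw [this]; exact isSingularKernel_lapKernel β
  have hsub := gaussian_subordination hn hβ0 hβ1 ha (P := fun _ => 1) measurable_const hK ξ
  have e0 : ∀ z : E n, (1 * (‖z‖ ^ (2 * a))⁻¹ : ℝ) = lapKernel n β z := by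
    intro z; simp only [lapKernel, one_mul, a]; congr 2; ring
  simp only [e0] at hsub
  set c : ℝ := π ^ 2 * ‖ξ‖ ^ 2
  have hinner : ∀ s ∈ Ioi (0 : ℝ), ((s ^ (a - 1) : ℝ) : ℂ) *
      ∫ z : E n, ((1 * Real.exp (-s * ‖z‖ ^ 2) : ℝ) : ℂ) * (character ξ z - 1) =
      ((π ^ ((n : ℝ) / 2) * (s ^ (β / 2 - 1) * (Real.exp (-c / s) - 1)) : ℝ) : ℂ) := by
    intro s hs
    have hs' : 0 < s := hs
    have hI : Integrable fun z : E n => (Real.exp (-s * ‖z‖ ^ 2) : ℂ) :=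
      (integrable_gaussian hs').ofReal
    have hI2 : Integrable fun z : E n => (Real.exp (-s * ‖z‖ ^ 2) : ℂ) * character ξ z :=
      hI.mul_bdd (continuous_character ξ).aestronglyMeasurable
        (Eventually.of_forall fun z => (norm_character ξ z).le)
    simp only [one_mul, mul_sub, mul_one]
    rw [integral_sub hI2 hI, integral_gaussian_mul_character hs']
    have h0 : ∫ z : E n, (Real.exp (-s * ‖z‖ ^ 2) : ℂ) = (((π / s) ^ ((n : ℝ) / 2) : ℝ) : ℂ) := by
      have := integral_gaussian_mul_character (n := n) hs' 0
      simpa [character] using this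
    rw [h0, ← Complex.ofReal_sub, ← Complex.ofReal_mul]
    congr 1
    rw [Real.div_rpow Real.pi_pos.le hs'.le]
    have : s ^ (a - 1) * (s ^ ((n : ℝ) / 2))⁻¹ = s ^ (β / 2 - 1) := by
      rw [← Real.rpow_neg hs'.le, ← Real.rpow_add hs']; congr 1; simp only [a]; ring
    rw [← this]; ring
  rw [setIntegral_congr_fun measurableSet_Ioi hinner, integral_complex_ofReal, integral_const_mul,
    integral_rpow_mul_exp_neg_div_sub_one (by positivity) (by linarith) (by positivity)] at hsub
  have hGa : Real.Gamma a ≠ 0 := (Real.Gamma_pos_of_pos ha).ne'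
  have hGb : Real.Gamma (-(β / 2)) ≠ 0 := by
    have := Real.Gamma_add_one (s := -(β / 2)) (by linarith)
    intro h0
    rw [h0, mul_zero] at this
    exact (Real.Gamma_pos_of_pos (s := -(β / 2) + 1) (by linarith)).ne' this
  have hcalc : nuConst n β * (π ^ ((n : ℝ) / 2) * (c ^ (β / 2) * Real.Gamma (-(β / 2)))) =
      Real.Gamma a * (2 * π * ‖ξ‖) ^ β := by
    have hc : c ^ (β / 2) = (π * ‖ξ‖) ^ β := by
      rw [show c = (π * ‖ξ‖) ^ (2 : ℝ) by rw [Real.rpow_two, mul_pow],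
        ← Real.rpow_mul (by positivity)]
      congr 1; ring
    have hpi : π ^ (-(n : ℝ) / 2) * π ^ ((n : ℝ) / 2) = 1 := by
      rw [← Real.rpow_add Real.pi_pos, show -(n : ℝ) / 2 + (n : ℝ) / 2 = 0 by ring, Real.rpow_zero]
    rw [hc, mul_assoc 2 π, Real.mul_rpow (x := 2) (by norm_num) (by positivity)]
    unfold nuConst
    rw [show -β / 2 = -(β / 2) by ring]
    change 2 ^ β * π ^ (-(n : ℝ) / 2) * (Real.Gamma a / _) * _ = _
    calc _ = 2 ^ β * (π ^ (-(n : ℝ) / 2) * π ^ ((n : ℝ) / 2)) * Real.Gamma a * (π * ‖ξ‖) ^ β *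
          (Real.Gamma (-(β / 2)) / Real.Gamma (-(β / 2))) := by ring
      _ = _ := by rw [hpi, div_self hGb]; ring
  have hGaC : (Real.Gamma a : ℂ) ≠ 0 := by exact_mod_cast hGa
  apply mul_left_cancel₀ hGaC
  rw [mul_left_comm, hsub, ← Complex.ofReal_mul, hcalc, Complex.ofReal_mul]

/-- The symbol of the `i`-th component of the fractional gradient. -/
lemma muConst_mul_symbol (hn : 1 ≤ n) {α : ℝ} (hα0 : 0 < α) (hα1 : α < 1) (i : Fin n) (ξ : E n) :
    (muConst n α : ℂ) * ∫ z, (gradKernel α i z : ℂ) * (character ξ z - 1) =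
      ((2 * π * ξ i) * (2 * π * ‖ξ‖) ^ (α - 1) : ℝ) * Complex.I := by
  rcases eq_or_ne ξ 0 with rfl | hξ
  · simp [character]
  have hξ' : 0 < ‖ξ‖ := norm_pos_iff.2 hξ
  have hn0 : (0 : ℝ) < n := by exact_mod_cast hn
  set a : ℝ := ((n : ℝ) + α + 1) / 2
  have ha : 0 < a := by positivity
  have e0 : ∀ z : E n, z i * (‖z‖ ^ (2 * a))⁻¹ = gradKernel α i z := by
    intro z; simp only [gradKernel, a]; congr 3; ring
  have hK : IsSingularKernel α (fun z : E n => z i * (‖z‖ ^ (2 * a))⁻¹) := by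
    simp_rw [e0]; exact isSingularKernel_gradKernel α i
  have hsub := gaussian_subordination hn hα0 hα1 ha (P := fun z => z i) (by fun_prop) hK ξ
  simp only [e0] at hsub
  set c : ℝ := π ^ 2 * ‖ξ‖ ^ 2
  have hinner : ∀ s ∈ Ioi (0 : ℝ), ((s ^ (a - 1) : ℝ) : ℂ) *
      ∫ z : E n, ((z i * Real.exp (-s * ‖z‖ ^ 2) : ℝ) : ℂ) * (character ξ z - 1) =
      ((π ^ ((n : ℝ) / 2) * (π * ξ i) * (s ^ (-((1 - α) / 2) - 1) * Real.exp (-c / s)) : ℝ) : ℂ) *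
        Complex.I := by
    intro s hs
    have hs' : 0 < s := hs
    have hI : Integrable fun z : E n => ((z i * Real.exp (-s * ‖z‖ ^ 2) : ℝ) : ℂ) :=
      (integrable_coord_mul_gaussian hn hs' i).ofReal
    have hI2 : Integrable fun z : E n =>
        ((z i * Real.exp (-s * ‖z‖ ^ 2) : ℝ) : ℂ) * character ξ z :=
      hI.mul_bdd (continuous_character ξ).aestronglyMeasurable
        (Eventually.of_forall fun z => (norm_character ξ z).le)
    simp only [mul_sub, mul_one]
    rw [integral_sub hI2 hI, integral_coord_mul_gaussian_mul_character hn hs']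
    have h0 : ∫ z : E n, ((z i * Real.exp (-s * ‖z‖ ^ 2) : ℝ) : ℂ) = 0 := by
      have := integral_coord_mul_gaussian_mul_character hn hs' (0 : E n) i
      simpa [character] using this
    rw [h0, sub_zero, mul_right_comm _ Complex.I, ← mul_assoc, ← Complex.ofReal_mul,
      ← Complex.ofReal_mul]
    congr 2
    rw [Real.div_rpow Real.pi_pos.le hs'.le]
    have : s ^ (a - 1) * (s ^ ((n : ℝ) / 2))⁻¹ * s⁻¹ = s ^ (-((1 - α) / 2) - 1) := by
      rw [← Real.rpow_neg hs'.le, ← Real.rpow_neg_one, ← Real.rpow_add hs', ← Real.rpow_add hs']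
      congr 1; simp only [a]; ring
    rw [← this]; ring
  have hc0 : 0 < c := by positivity
  rw [setIntegral_congr_fun measurableSet_Ioi hinner, integral_mul_const, integral_complex_ofReal,
    integral_const_mul, integral_rpow_mul_exp_neg_div (by linarith) hc0] at hsub
  have hGa : Real.Gamma a ≠ 0 := (Real.Gamma_pos_of_pos ha).ne'
  have hGb : Real.Gamma ((1 - α) / 2) ≠ 0 := (Real.Gamma_pos_of_pos (by linarith)).ne'
  have hcalc : muConst n α * (π ^ ((n : ℝ) / 2) * (π * ξ i) *
      (c ^ (-((1 - α) / 2)) * Real.Gamma ((1 - α) / 2))) =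
      Real.Gamma a * ((2 * π * ξ i) * (2 * π * ‖ξ‖) ^ (α - 1)) := by
    have hc : c ^ (-((1 - α) / 2)) = (π * ‖ξ‖) ^ (α - 1) := by
      rw [show c = (π * ‖ξ‖) ^ (2 : ℝ) by rw [Real.rpow_two, mul_pow],
        ← Real.rpow_mul (by positivity)]
      congr 1; ring
    have hpi : π ^ (-(n : ℝ) / 2) * π ^ ((n : ℝ) / 2) = 1 := by
      rw [← Real.rpow_add Real.pi_pos, show -(n : ℝ) / 2 + (n : ℝ) / 2 = 0 by ring, Real.rpow_zero]
    have h2 : (2 : ℝ) ^ α = 2 * 2 ^ (α - 1) := by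
      rw [mul_comm, ← Real.rpow_add_one (by norm_num)]; congr 1; ring
    rw [hc, mul_assoc 2 π ‖ξ‖, Real.mul_rpow (x := 2) (by norm_num) (by positivity)]
    unfold muConst
    change 2 ^ α * π ^ (-(n : ℝ) / 2) * (Real.Gamma a / _) * _ = _
    rw [h2]
    calc _ = 2 * 2 ^ (α - 1) * (π ^ (-(n : ℝ) / 2) * π ^ ((n : ℝ) / 2)) * Real.Gamma a *
          (π * ξ i) * (π * ‖ξ‖) ^ (α - 1) *
          (Real.Gamma ((1 - α) / 2) / Real.Gamma ((1 - α) / 2)) := by ring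
      _ = _ := by rw [hpi, div_self hGb]; ring
  have hGaC : (Real.Gamma a : ℂ) ≠ 0 := by exact_mod_cast hGa
  apply mul_left_cancel₀ hGaC
  rw [mul_left_comm, hsub, ← mul_assoc, ← Complex.ofReal_mul, hcalc, Complex.ofReal_mul]
  ring

/-! ### Composition of the fractional operators -/

lemma IsTestFun.continuous_levy (hn : 1 ≤ n) {β : ℝ} (hβ0 : 0 < β) (hβ1 : β < 1)
    {K ψ : E n → ℝ} (hK : IsSingularKernel β K) (hψ : IsTestFun ψ) : Continuous (levy K ψ) := by
  obtain ⟨C, hC0, hC⟩ := hψ.exists_translate_bound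
  refine continuous_of_dominated (F := fun x z => K z * (ψ (x + z) - ψ x))
    (bound := fun z => C * (min 1 ‖z‖ * lapKernel n β z)) (fun x => ?_)
    (fun x => Eventually.of_forall fun z => ?_)
    ((integrable_min_mul_lapKernel hn hβ0 hβ1).const_mul C) (Eventually.of_forall fun z => ?_)
  · exact hK.measurable.aestronglyMeasurable.mul
      (((hψ.continuous.comp (continuous_const.add continuous_id)).sub
        continuous_const).aestronglyMeasurable)
  · rw [norm_mul]
    calc ‖K z‖ * ‖ψ (x + z) - ψ x‖ ≤ lapKernel n β z * (C * min 1 ‖z‖) := by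
          gcongr
          · exact lapKernel_nonneg β z
          · exact hK.abs_le z
          · exact hC x z
      _ = _ := by ring
  · exact continuous_const.mul ((hψ.continuous.comp (continuous_id.add continuous_const)).sub
      hψ.continuous)

/-- A real test function as a complex Schwartz function. -/
noncomputable def IsTestFun.toSchwartz {ψ : E n → ℝ} (hψ : IsTestFun ψ) :
    SchwartzMap (E n) ℂ :=
  HasCompactSupport.toSchwartzMap (f := fun x => (ψ x : ℂ))
    (hψ.2.comp_left (g := fun r : ℝ => (r : ℂ)) Complex.ofReal_zero)
    (Complex.ofRealCLM.contDiff.comp hψ.1)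

lemma IsTestFun.integrable_pow_mul_fourier {ψ : E n → ℝ} (hψ : IsTestFun ψ) (k : ℕ) :
    Integrable fun ξ => ‖ξ‖ ^ k * ‖𝓕 (fun x => (ψ x : ℂ)) ξ‖ :=
  (𝓕 hψ.toSchwartz).integrable_pow_mul volume k

lemma IsTestFun.fourier_fderiv {ψ : E n → ℝ} (hψ : IsTestFun ψ) (v ξ : E n) :
    𝓕 (fun x => ((fderiv ℝ ψ x v : ℝ) : ℂ)) ξ =
      (2 * π * ⟪ξ, v⟫ : ℝ) * Complex.I * 𝓕 (fun x => (ψ x : ℂ)) ξ := by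
  have h := congrArg (fun f : SchwartzMap (E n) ℂ => f ξ)
    (SchwartzMap.fourier_lineDerivOp_eq hψ.toSchwartz v)
  have htg : (inner ℝ · v : E n → ℝ).HasTemperateGrowth := by fun_prop
  simp only [smul_apply, SchwartzMap.smulLeftCLM_apply_apply htg] at h
  have h1 : (LineDeriv.lineDerivOp v hψ.toSchwartz : E n → ℂ) =
      fun x => ((fderiv ℝ ψ x v : ℝ) : ℂ) := by
    ext x
    rw [SchwartzMap.lineDerivOp_apply_eq_fderiv]
    have h2 : HasFDerivAt (fun x => (ψ x : ℂ)) (Complex.ofRealCLM.comp (fderiv ℝ ψ x)) x :=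
      Complex.ofRealCLM.hasFDerivAt.comp x (hψ.differentiable x).hasFDerivAt
    have h3 : fderiv ℝ (hψ.toSchwartz : E n → ℂ) x = Complex.ofRealCLM.comp (fderiv ℝ ψ x) :=
      h2.fderiv
    rw [h3]; rfl
  rw [SchwartzMap.fourier_coe, h1, SchwartzMap.fourier_coe] at h
  rw [h]
  simp only [smul_eq_mul, Complex.real_smul]
  change _ = _ * _ * 𝓕 (hψ.toSchwartz : E n → ℂ) ξ
  push_cast; ring

/-- Self-adjointness of the inverse Fourier transform. -/
lemma integral_mul_fourierInv {F G : E n → ℂ} (hF : Integrable F) (hG : Integrable G) :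
    ∫ x, F x * 𝓕⁻ G x = ∫ ξ, 𝓕⁻ F ξ * G ξ := by
  have hc : Continuous fun p : E n × E n => (-innerₗ (E n)) p.1 p.2 := by
    exact (continuous_fst.inner continuous_snd).neg
  have h := VectorFourier.integral_fourierIntegral_smul_eq_flip (μ := volume) (ν := volume)
    (L := -innerₗ (E n)) Real.continuous_fourierChar hc hF hG
  have hfl : (-innerₗ (E n)).flip = -innerₗ (E n) := by
    ext x y; simp [real_inner_comm]
  rw [hfl] at h
  exact h.symm

lemma continuous_fourier {F : E n → ℂ} (hF : Integrable F) : Continuous (𝓕 F) :=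
  VectorFourier.fourierIntegral_continuous Real.continuous_fourierChar continuous_inner hF

/-- The fractional Laplacian of order `1 - α` and the `i`-th fractional derivative of order `α`
compose to the `i`-th partial derivative, in duality: the product of the two symbols is
`(2π|ξ|)^{1-α} · 2πi ξᵢ (2π|ξ|)^{α-1} = 2πi ξᵢ`. -/
lemma integral_fracLaplacian_mul_levy (hn : 1 ≤ n) {α : ℝ} (hα0 : 0 < α) (hα1 : α < 1)
    {u : E n → ℝ} (hu : Integrable u)
    (hui : Integrable (levyIntegrand (lapKernel n (1 - α)) u) (volume.prod volume))
    {ψ : E n → ℝ} (hψ : IsTestFun ψ) (i : Fin n) :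
    ∫ x, fracLaplacian (1 - α) u x * (muConst n α * levy (gradKernel α i) ψ x) =
      ∫ x, u x * fderiv ℝ ψ x (EuclideanSpace.single i (1 : ℝ)) := by
  have hψi := hψ.integrable_levyIntegrand hn hα0 hα1 (isSingularKernel_gradKernel α i)
  set F : E n → ℂ := fun x => (nuConst n (1 - α) : ℂ) * (levy (lapKernel n (1 - α)) u x : ℂ)
  set G : E n → ℂ := fun x => (muConst n α : ℂ) * (levy (gradKernel α i) ψ x : ℂ)
  set U : E n → ℂ := fun x => (u x : ℂ)
  set Ψ : E n → ℂ := fun x => (ψ x : ℂ)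
  set D : E n → ℂ := fun x =>
    ((fderiv ℝ ψ x (EuclideanSpace.single i (1 : ℝ)) : ℝ) : ℂ)
  have hUi : Integrable U := hu.ofReal
  have hFi : Integrable F := (integrable_levy hui).ofReal.const_mul _
  have hGi : Integrable G := (integrable_levy hψi).ofReal.const_mul _
  have hdψ := hψ.fderiv_apply (EuclideanSpace.single i (1 : ℝ))
  have hDi : Integrable D := hdψ.integrable.ofReal
  have hFF : ∀ ξ, 𝓕 F ξ = ((2 * π * ‖ξ‖) ^ (1 - α) : ℝ) * 𝓕 U ξ := by
    intro ξ
    have h1 : 𝓕 F ξ = (nuConst n (1 - α) : ℂ) *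
        𝓕 (fun x => (levy (lapKernel n (1 - α)) u x : ℂ)) ξ := by
      simp only [F, Real.fourier_eq', smul_eq_mul, ← integral_const_mul]
      congr 1; ext x; ring
    rw [h1, fourier_levy hu hui, mul_left_comm,
      ← nuConst_mul_symbol hn (by linarith : 0 < 1 - α) (by linarith) ξ]
    simp only [character, U]
    ring
  have hGG : ∀ ξ, 𝓕 G ξ =
      ((2 * π * ξ i) * (2 * π * ‖ξ‖) ^ (α - 1) : ℝ) * Complex.I * 𝓕 Ψ ξ := by
    intro ξ
    have h1 : 𝓕 G ξ = (muConst n α : ℂ) *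
        𝓕 (fun x => (levy (gradKernel α i) ψ x : ℂ)) ξ := by
      simp only [G, Real.fourier_eq', smul_eq_mul, ← integral_const_mul]
      congr 1; ext x; ring
    rw [h1, fourier_levy hψ.integrable hψi, mul_left_comm, ← muConst_mul_symbol hn hα0 hα1 i ξ]
    simp only [character, Ψ]
    ring
  have hDD : ∀ ξ, 𝓕 D ξ = (2 * π * ξ i : ℝ) * Complex.I * 𝓕 Ψ ξ := by
    intro ξ
    have := hψ.fourier_fderiv (EuclideanSpace.single i (1 : ℝ)) ξ
    simpa [EuclideanSpace.inner_single_right] using this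
  have hfG : Integrable (𝓕 G) := by
    refine (((hψ.integrable_pow_mul_fourier 0).add
      ((hψ.integrable_pow_mul_fourier 1).const_mul (2 * π)))).mono'
      (continuous_fourier hGi).aestronglyMeasurable (Eventually.of_forall fun ξ => ?_)
    rw [hGG, norm_mul, norm_mul, Complex.norm_I, mul_one, Complex.norm_real]
    simp only [pow_zero, one_mul, pow_one, Pi.add_apply, ← mul_assoc]
    rw [← one_add_mul]
    gcongr
    rcases eq_or_ne ξ 0 with rfl | hξ
    · simp
    have hr : 0 < 2 * π * ‖ξ‖ := by
      have := norm_pos_iff.2 hξ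
      positivity
    have hαle : (2 * π * ‖ξ‖) ^ α ≤ 1 + 2 * π * ‖ξ‖ := by
      rcases le_total (2 * π * ‖ξ‖) 1 with h | h
      · have := Real.rpow_le_one hr.le h hα0.le
        linarith
      · have := Real.rpow_le_rpow_of_exponent_le h hα1.le
        rw [Real.rpow_one] at this
        linarith
    refine le_trans ?_ hαle
    rw [norm_mul, Real.norm_of_nonneg (Real.rpow_nonneg hr.le _), norm_mul,
      Real.norm_of_nonneg (by positivity : 0 ≤ 2 * π)]
    calc 2 * π * ‖ξ i‖ * (2 * π * ‖ξ‖) ^ (α - 1)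
        ≤ 2 * π * ‖ξ‖ * (2 * π * ‖ξ‖) ^ (α - 1) := by
          gcongr
          exact PiLp.norm_apply_le ξ i
      _ = (2 * π * ‖ξ‖) ^ α := by
          rw [mul_comm, ← Real.rpow_add_one hr.ne']; congr 1; ring
  have hfD : Integrable (𝓕 D) := by
    have := hdψ.integrable_pow_mul_fourier 0
    simp only [pow_zero, one_mul] at this
    exact (integrable_norm_iff (continuous_fourier hDi).aestronglyMeasurable).1 this
  have hGinv : 𝓕⁻ (𝓕 G) = G :=
    (continuous_const.mul (Complex.continuous_ofReal.comp
      (hψ.continuous_levy hn hα0 hα1 (isSingularKernel_gradKernel α i)))).fourierInv_fourier_eq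
      hGi hfG
  have hDinv : 𝓕⁻ (𝓕 D) = D :=
    (Complex.continuous_ofReal.comp hdψ.continuous).fourierInv_fourier_eq hDi hfD
  have hcomplex : ∫ x, F x * G x = ∫ x, U x * D x := by
    calc ∫ x, F x * G x = ∫ x, F x * 𝓕⁻ (𝓕 G) x := by rw [hGinv]
      _ = ∫ ξ, 𝓕⁻ F ξ * 𝓕 G ξ := integral_mul_fourierInv hFi hfG
      _ = ∫ ξ, 𝓕⁻ U ξ * 𝓕 D ξ := by
          congr 1; ext ξ
          rw [Real.fourierInv_eq_fourier_neg, Real.fourierInv_eq_fourier_neg, hFF, hGG, hDD,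
            norm_neg]
          rcases eq_or_ne ξ 0 with rfl | hξ
          · simp
          have hr : 0 < 2 * π * ‖ξ‖ := by
            have := norm_pos_iff.2 hξ
            positivity
          have hone : (2 * π * ‖ξ‖) ^ (1 - α) * (2 * π * ‖ξ‖) ^ (α - 1) = 1 := by
            rw [← Real.rpow_add hr, show 1 - α + (α - 1) = 0 by ring, Real.rpow_zero]
          have honeC : (((2 * π * ‖ξ‖) ^ (1 - α) : ℝ) : ℂ) * (((2 * π * ‖ξ‖) ^ (α - 1) : ℝ) : ℂ)
              = 1 := by
            rw [← Complex.ofReal_mul, hone, Complex.ofReal_one]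
          rw [Complex.ofReal_mul (2 * π * ξ i)]
          linear_combination (𝓕 U (-ξ) * ((2 * π * ξ i : ℝ) : ℂ) * Complex.I * 𝓕 Ψ ξ) * honeC
      _ = ∫ x, U x * 𝓕⁻ (𝓕 D) x := (integral_mul_fourierInv hUi hfD).symm
      _ = ∫ x, U x * D x := by rw [hDinv]
  have e1 : ∀ x, F x * G x =
      ((fracLaplacian (1 - α) u x * (muConst n α * levy (gradKernel α i) ψ x) : ℝ) : ℂ) := by
    intro x
    rw [fracLaplacian_eq_levy]; simp only [F, G]; push_cast; ring
  have e2 : ∀ x, U x * D x =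
      ((u x * fderiv ℝ ψ x (EuclideanSpace.single i (1 : ℝ)) : ℝ) : ℂ) := by
    intro x; simp only [U, D]; push_cast; ring
  simp_rw [e1, e2, integral_complex_ofReal] at hcomplex
  exact_mod_cast hcomplex

/-- The fractional divergence in terms of the components of the field. -/
lemma fracDiv_eq_sum_levy (hn : 1 ≤ n) {α : ℝ} (hα0 : 0 < α) (hα1 : α < 1)
    {φ : E n → E n} (hφ : IsTestField φ) (x : E n) :
    fracDiv α φ x = ∑ i, muConst n α * levy (gradKernel α i) (fun y => φ y i) x := by
  rw [fracDiv, ← Finset.mul_sum]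
  congr 1
  have h0 : ∫ y : E n, ⟪y - x, φ y - φ x⟫ / ‖y - x‖ ^ ((n : ℝ) + α + 1) =
      ∫ z : E n, ⟪z, φ (x + z) - φ x⟫ / ‖z‖ ^ ((n : ℝ) + α + 1) := by
    rw [← integral_add_left_eq_self _ x]; simp
  rw [h0]
  simp only [levy]
  rw [← integral_finsetSum]
  · congr 1; ext z
    rw [PiLp.inner_apply, Finset.sum_div]
    refine Finset.sum_congr rfl fun i _ => ?_
    simp [gradKernel]
    ring
  · intro i _
    obtain ⟨C, hC0, hC⟩ := (hφ.component i).exists_translate_bound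
    refine ((integrable_min_mul_lapKernel hn hα0 hα1).const_mul C).mono' ?_
      (Eventually.of_forall fun z => ?_)
    · exact (isSingularKernel_gradKernel α i).measurable.aestronglyMeasurable.mul
        ((((hφ.component i).continuous.comp (continuous_const.add continuous_id)).sub
          continuous_const).aestronglyMeasurable)
    · rw [norm_mul]
      calc _ ≤ lapKernel n α z * (C * min 1 ‖z‖) := by
            gcongr
            · exact lapKernel_nonneg α z
            · exact (isSingularKernel_gradKernel α i).abs_le z
            · exact hC x z
        _ = _ := by ring

lemma IsTestFun.exists_levy_bound (hn : 1 ≤ n) {β : ℝ} (hβ0 : 0 < β) (hβ1 : β < 1)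
    {K ψ : E n → ℝ} (hK : IsSingularKernel β K) (hψ : IsTestFun ψ) :
    ∃ C, ∀ x, |levy K ψ x| ≤ C := by
  obtain ⟨C, hC0, hC⟩ := hψ.exists_translate_bound
  refine ⟨∫ z, C * (min 1 ‖z‖ * lapKernel n β z), fun x => ?_⟩
  rw [← Real.norm_eq_abs, levy]
  refine norm_integral_le_of_norm_le ((integrable_min_mul_lapKernel hn hβ0 hβ1).const_mul C)
    (Eventually.of_forall fun z => ?_)
  rw [norm_mul]
  calc _ ≤ lapKernel n β z * (C * min 1 ‖z‖) := by
        gcongr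
        · exact lapKernel_nonneg β z
        · exact hK.abs_le z
        · exact hC x z
    _ = _ := by ring

lemma integral_mul_fracDiv (hn : 1 ≤ n) {α : ℝ} (hα0 : 0 < α) (hα1 : α < 1)
    {f : E n → ℝ} (hf : Integrable f) {φ : E n → E n} (hφ : IsTestField φ) :
    ∫ x, f x * fracDiv α φ x =
      ∑ i, ∫ x, f x * (muConst n α * levy (gradKernel α i) (fun y => φ y i) x) := by
  rw [← integral_finsetSum]
  · simp_rw [fracDiv_eq_sum_levy hn hα0 hα1 hφ, Finset.mul_sum]
  · intro i _
    have hK := isSingularKernel_gradKernel (n := n) α i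
    obtain ⟨C, hC⟩ := (hφ.component i).exists_levy_bound hn hα0 hα1 hK
    refine hf.mul_bdd (c := |muConst n α| * C) ?_ (Eventually.of_forall fun x => ?_)
    · exact (continuous_const.mul
        ((hφ.component i).continuous_levy hn hα0 hα1 hK)).aestronglyMeasurable
    · rw [norm_mul]
      exact mul_le_mul_of_nonneg_left (hC x) (norm_nonneg _)

/-- `(-Δ)^{(1-α)/2} div^α = div` in duality. -/
lemma integral_fracLaplacian_mul_fracDiv (hn : 1 ≤ n) {α : ℝ} (hα0 : 0 < α) (hα1 : α < 1)
    {u : E n → ℝ} (hu : Integrable u)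
    (hui : Integrable (levyIntegrand (lapKernel n (1 - α)) u) (volume.prod volume))
    {φ : E n → E n} (hφ : IsTestField φ) :
    ∫ x, fracLaplacian (1 - α) u x * fracDiv α φ x = ∫ x, u x * divergence φ x := by
  rw [integral_mul_fracDiv hn hα0 hα1 (integrable_fracLaplacian hui) hφ, integral_mul_divergence hφ hu]
  exact Finset.sum_congr rfl fun i _ =>
    integral_fracLaplacian_mul_levy hn hα0 hα1 hu hui (hφ.component i) i

/-! ### Inclusions between the fractional spaces -/

lemma gradKernel_neg (α : ℝ) (i : Fin n) (z : E n) : gradKernel α i (-z) = -gradKernel α i z := by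
  simp [gradKernel]

/-- Functions with an integrable weak fractional gradient have finite fractional variation. -/
lemma fracS_subset_fracBV (n : ℕ) (α : ℝ) : fracS n α ⊆ fracBV n α := by
  rintro f ⟨hf, g, hg, h⟩
  refine ⟨hf, ?_⟩
  have hgi := memLp_one_iff_integrable.1 hg
  refine lt_of_le_of_lt (b := ENNReal.ofReal (∫ x, ‖g x‖)) ?_ ENNReal.ofReal_lt_top
  refine iSup_le fun φ => iSup_le fun hφ => iSup_le fun hφ1 => ?_
  rw [h φ hφ]
  refine ENNReal.ofReal_le_ofReal ?_
  refine (neg_le_abs _).trans ?_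
  rw [← Real.norm_eq_abs]
  refine norm_integral_le_of_norm_le hgi.norm
    (Eventually.of_forall fun x => (norm_inner_le_norm _ _).trans ?_)
  exact mul_le_of_le_one_right (norm_nonneg _) (hφ1 x)

/-- Functions of finite Gagliardo seminorm have the integrable weak fractional gradient
`μ ∫ z (f(x+z) - f(x)) |z|^{-n-α-1} dz`. -/
lemma fracW_subset_fracS (hn : 1 ≤ n) {α : ℝ} (hα0 : 0 < α) (hα1 : α < 1) :
    fracW n α ⊆ fracS n α := by
  intro f hf
  obtain ⟨hfi, hK⟩ := mem_fracW_iff.1 hf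
  have hKi : ∀ i, Integrable (levyIntegrand (gradKernel α i) f) (volume.prod volume) := fun i =>
    (isSingularKernel_gradKernel α i).integrable_levyIntegrand hfi.aestronglyMeasurable hK
  refine ⟨hf.1, fun x => WithLp.toLp 2 fun i => muConst n α * levy (gradKernel α i) f x, ?_, ?_⟩
  · rw [memLp_one_iff_integrable, integrable_piLp_iff]
    exact fun i => (integrable_levy (hKi i)).const_mul _
  · intro φ hφ
    rw [integral_mul_fracDiv hn hα0 hα1 hfi hφ]
    have h1 : ∀ i, ∫ x, f x * (muConst n α * levy (gradKernel α i) (fun y => φ y i) x) =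
        -∫ x, muConst n α * levy (gradKernel α i) f x * φ x i := by
      intro i
      have := integral_mul_levy_of_odd hn hα0 hα1 (isSingularKernel_gradKernel α i)
        (gradKernel_neg α i) hfi (hKi i) (hφ.component i)
      simp_rw [mul_left_comm (f _), mul_assoc]
      rw [integral_const_mul, integral_const_mul, this, mul_neg]
    simp_rw [h1, Finset.sum_neg_distrib]
    congr 1
    rw [← integral_finsetSum]
    · congr 1; ext x
      rw [PiLp.inner_apply]
      refine Finset.sum_congr rfl fun i _ => ?_
      simp [mul_comm]
    · intro i _
      exact (hφ.component i).integrable_mul ((integrable_levy (hKi i)).const_mul _)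

/-! ### The indicator function of the unit ball -/

lemma tendsto_one_div_add_one_nhdsNE :
    Tendsto (fun k : ℕ => 1 / ((k : ℝ) + 1)) atTop (𝓝[≠] 0) :=
  tendsto_nhdsWithin_iff.2 ⟨tendsto_one_div_add_atTop_nhds_zero_nat,
    Eventually.of_forall fun k => by simp only [mem_compl_iff, mem_singleton_iff]; positivity⟩

/-- The `L¹` norm of a difference quotient is bounded by the translation constant. -/
lemma integral_abs_diffQuot_le {u : E n → ℝ} {C : ℝ}
    (hC : ∀ z, ∫ x, |u (x + z) - u x| ≤ C * ‖z‖) (i : Fin n) {t : ℝ} (ht : 0 < t) :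
    ∫ x, |t⁻¹ * (u (x + (-t) • EuclideanSpace.single i (1 : ℝ)) - u x)| ≤ C := by
  simp_rw [abs_mul]
  rw [integral_const_mul, abs_of_pos (inv_pos.2 ht), inv_mul_le_iff₀ ht]
  refine (hC _).trans (le_of_eq ?_)
  rw [norm_smul]
  simp [abs_of_pos ht, mul_comm]

/-- The converse of the translation estimate for functions of bounded variation. -/
lemma variation_lt_top_of_translate {u : E n → ℝ} (hu : Integrable u) {C : ℝ}
    (hC : ∀ z, ∫ x, |u (x + z) - u x| ≤ C * ‖z‖) : variation u < ⊤ := by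
  refine lt_of_le_of_lt (b := ENNReal.ofReal (∑ _i : Fin n, C)) ?_ ENNReal.ofReal_lt_top
  refine iSup_le fun φ => iSup_le fun hφ => iSup_le fun hφ1 => ENNReal.ofReal_le_ofReal ?_
  rw [integral_mul_divergence hφ hu]
  refine Finset.sum_le_sum fun i _ => ?_
  have hlim := tendsto_integral_diffQuot_mul hu (hφ.component i)
    (EuclideanSpace.single i (1 : ℝ)) tendsto_one_div_add_one_nhdsNE
  refine le_of_tendsto' hlim fun k => ?_
  have ht : 0 < 1 / ((k : ℝ) + 1) := by positivity
  have hI : Integrable fun x => (1 / ((k : ℝ) + 1))⁻¹ *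
      (u (x + (-(1 / ((k : ℝ) + 1))) • EuclideanSpace.single i (1 : ℝ)) - u x) :=
    ((hu.comp_add_right _).sub hu).const_mul _
  refine le_trans ((Real.le_norm_self _).trans (norm_integral_le_of_norm_le hI.norm
    (Eventually.of_forall fun x => ?_))) (integral_abs_diffQuot_le hC i ht)
  rw [norm_mul]
  exact mul_le_of_le_one_right (norm_nonneg _) ((PiLp.norm_apply_le _ i).trans (hφ1 x))

/-- Convexity of `t ↦ (1 + t)ⁿ` on `[0, 1]`: the graph lies below the chord. -/
lemma one_add_pow_le (n : ℕ) {t : ℝ} (h0 : 0 ≤ t) (h1 : t ≤ 1) :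
    (1 + t) ^ n ≤ 1 + (2 ^ n - 1) * t := by
  induction n with
  | zero => simp
  | succ n ih =>
    have h2 : (1 : ℝ) ≤ 2 ^ n := one_le_pow₀ (by norm_num)
    calc (1 + t) ^ (n + 1) = (1 + t) ^ n * (1 + t) := pow_succ _ _
      _ ≤ (1 + (2 ^ n - 1) * t) * (1 + t) := by gcongr
      _ ≤ 1 + (2 ^ (n + 1) - 1) * t := by
        rw [pow_succ]
        nlinarith [mul_nonneg (sub_nonneg.2 h2) (mul_nonneg h0 (sub_nonneg.2 h1))]

/-- The indicator function of the open unit ball. -/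
noncomputable def ballIndicator (n : ℕ) : E n → ℝ :=
  (Metric.ball (0 : E n) 1).indicator fun _ => 1

lemma integrable_ballIndicator (n : ℕ) : Integrable (ballIndicator n) :=
  (integrable_indicator_iff measurableSet_ball).2 (integrableOn_const measure_ball_lt_top.ne)

lemma measureReal_annulus_le (x : E n) {r : ℝ} (hr0 : 0 ≤ r) (hr1 : r ≤ 1) :
    volume.real (Metric.ball x (1 + r) \ Metric.ball x 1) ≤
      (2 ^ n - 1) * r * volume.real (Metric.ball (0 : E n) 1) := by
  have hball : ∀ s : ℝ, 0 < s →
      volume.real (Metric.ball x s) = s ^ n * volume.real (Metric.ball (0 : E n) 1) := by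
    intro s hs
    rw [measureReal_def, Measure.addHaar_ball_of_pos volume x hs, ENNReal.toReal_mul,
      ENNReal.toReal_ofReal (by positivity), finrank_euclideanSpace_fin, measureReal_def]
  rw [measureReal_sdiff (Metric.ball_subset_ball (by linarith)) measurableSet_ball,
    hball _ (by linarith), hball 1 one_pos, one_pow]
  have := one_add_pow_le n hr0 hr1
  have h0 : 0 ≤ volume.real (Metric.ball (0 : E n) 1) := by positivity
  nlinarith [mul_le_mul_of_nonneg_right this h0]

lemma ballIndicator_translate_le (n : ℕ) : ∃ C, ∀ z : E n,
    ∫ x, |ballIndicator n (x + z) - ballIndicator n x| ≤ C * ‖z‖ := by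
  set V := volume.real (Metric.ball (0 : E n) 1)
  have hV : 0 ≤ V := by positivity
  have h2n : (1 : ℝ) ≤ 2 ^ n := one_le_pow₀ (by norm_num)
  refine ⟨2 * (∫ x, |ballIndicator n x|) + 2 * ((2 ^ n - 1) * V), fun z => ?_⟩
  have hA0 : 0 ≤ ∫ x, |ballIndicator n x| := by positivity
  have hB0 : 0 ≤ (2 ^ n - 1) * V := mul_nonneg (by linarith) hV
  rcases le_total ‖z‖ 1 with hz | hz
  · -- the difference is supported in two annuli of width `‖z‖`, around the two centres `0` and `-z`
    set S := Metric.ball (0 : E n) (1 + ‖z‖) \ Metric.ball 0 1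
    set T := Metric.ball (-z) (1 + ‖z‖) \ Metric.ball (-z) 1
    have hS : MeasurableSet S := measurableSet_ball.diff measurableSet_ball
    have hT : MeasurableSet T := measurableSet_ball.diff measurableSet_ball
    have hSi : Integrable (S.indicator fun _ => (1 : ℝ)) :=
      (integrable_indicator_iff hS).2 (integrableOn_const
        (measure_ne_top_of_subset sdiff_subset measure_ball_lt_top.ne))
    have hTi : Integrable (T.indicator fun _ => (1 : ℝ)) :=
      (integrable_indicator_iff hT).2 (integrableOn_const
        (measure_ne_top_of_subset sdiff_subset measure_ball_lt_top.ne))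
    have hle : ∫ x, |ballIndicator n (x + z) - ballIndicator n x| ≤
        ∫ x, S.indicator (fun _ => (1 : ℝ)) x + T.indicator (fun _ => (1 : ℝ)) x := by
      refine integral_mono (((integrable_ballIndicator n).comp_add_right z).sub
        (integrable_ballIndicator n)).abs (hSi.add hTi) fun x => ?_
      have hn1 : ‖x + z‖ ≤ ‖x‖ + ‖z‖ := norm_add_le _ _
      have hn2 : ‖x‖ ≤ ‖x + z‖ + ‖z‖ := by simpa using norm_sub_le (x + z) z
      have hd : dist x (-z) = ‖x + z‖ := by rw [dist_eq_norm, sub_neg_eq_add]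
      simp only [ballIndicator, indicator, S, T, Set.mem_sdiff, Metric.mem_ball, dist_zero_right, hd]
      by_cases h1 : ‖x + z‖ < 1 <;> by_cases h2 : ‖x‖ < 1
      · simp [h1, h2]
      · have h3 : ‖x‖ < 1 + ‖z‖ := by linarith
        simp [h1, h2, h3]
      · have h3 : ‖x + z‖ < 1 + ‖z‖ := by linarith
        simp [h1, h2, h3]
      · simp only [h1, h2, if_false, sub_zero, abs_zero]
        positivity
    rw [integral_add hSi hTi, integral_indicator_const _ hS, integral_indicator_const _ hT] at hle
    have hS' := measureReal_annulus_le (0 : E n) (norm_nonneg z) hz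
    have hT' := measureReal_annulus_le (-z) (norm_nonneg z) hz
    simp only [smul_eq_mul, mul_one] at hle
    have : 0 ≤ 2 * (∫ x, |ballIndicator n x|) * ‖z‖ := by positivity
    change volume.real S ≤ _ at hS'
    change volume.real T ≤ _ at hT'
    nlinarith
  · have := integral_abs_translate_sub_le_two_mul (integrable_ballIndicator n) z
    nlinarith

/-- The integral of a derivative of a test function vanishes. -/
lemma IsTestFun.integral_fderiv_eq_zero {ψ : E n → ℝ} (hψ : IsTestFun ψ) (v : E n) :
    ∫ x, fderiv ℝ ψ x v = 0 := by
  have h := integral_mul_fderiv_eq_neg_fderiv_mul_of_integrable (μ := volume) (𝕜 := ℝ)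
    (f := fun _ : E n => (1 : ℝ)) (g := ψ) (v := v) (by simp)
    (by simpa using (hψ.fderiv_apply v).integrable) (by simpa using hψ.integrable)
    (fun _ _ => differentiableAt_const _) (fun x _ => hψ.differentiable x)
  simpa using h

lemma ballIndicator_mem_BV (n : ℕ) : ballIndicator n ∈ BV n := by
  obtain ⟨C, hC⟩ := ballIndicator_translate_le n
  exact ⟨memLp_one_iff_integrable.2 (integrable_ballIndicator n),
    variation_lt_top_of_translate (integrable_ballIndicator n) hC⟩

/-- A weak gradient of the indicator of the ball vanishes on every open set on which the indicator
is constant. -/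
lemma ae_eq_zero_of_weak_gradient_ballIndicator {g : E n → E n} (hg : Integrable g)
    (h : ∀ φ : E n → E n, IsTestField φ →
      ∫ x, ballIndicator n x * divergence φ x = -∫ x, ⟪g x, φ x⟫)
    {U : Set (E n)} (hU : IsOpen U) {c : ℝ} (hc : ∀ x ∈ U, ballIndicator n x = c) :
    ∀ᵐ x, x ∈ U → g x = 0 := by
  have hi : ∀ i, ∀ᵐ x, x ∈ U → g x i = 0 := by
    intro i
    refine hU.ae_eq_zero_of_integral_contDiff_smul_eq_zero
      ((hg.eval_piLp i).locallyIntegrable.locallyIntegrableOn U) fun ψ hψs hψc hψU => ?_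
    have hψ : IsTestFun ψ := ⟨hψs, hψc⟩
    have h1 := h _ (hψ.smul_const (EuclideanSpace.single i (1 : ℝ)))
    simp_rw [divergence_smul_const hψ] at h1
    have h2 : ∀ x, ballIndicator n x * fderiv ℝ ψ x (EuclideanSpace.single i (1 : ℝ)) =
        c * fderiv ℝ ψ x (EuclideanSpace.single i (1 : ℝ)) := by
      intro x
      by_cases hx : x ∈ tsupport ψ
      · rw [hc x (hψU hx)]
      · have : fderiv ℝ ψ x = 0 := image_eq_zero_of_notMem_tsupport fun h' =>
          hx (tsupport_fderiv_subset ℝ h')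
        simp [this]
    simp_rw [h2] at h1
    rw [integral_const_mul, hψ.integral_fderiv_eq_zero, mul_zero] at h1
    have h3 : ∀ x, ⟪g x, ψ x • EuclideanSpace.single i (1 : ℝ)⟫ = ψ x • g x i := by
      intro x; rw [inner_smul_right, EuclideanSpace.inner_single_right]; simp
    simp_rw [h3] at h1
    linarith
  filter_upwards [ae_all_iff.2 hi] with x hx hxU
  ext i
  exact hx i hxU

/-- The indicator of the ball has no integrable weak gradient: it would vanish off the sphere,
hence almost everywhere, although the flux of the identity field through the sphere is nonzero. -/
lemma ballIndicator_notMem_W11 (hn : 1 ≤ n) : ballIndicator n ∉ W11 n := by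
  have : Nonempty (Fin n) := ⟨⟨0, hn⟩⟩
  rintro ⟨-, g, hg, h⟩
  rw [memLp_one_iff_integrable] at hg
  have h1 := ae_eq_zero_of_weak_gradient_ballIndicator hg h (U := Metric.ball 0 1) Metric.isOpen_ball
    (c := 1)
    fun x hx => by simp [ballIndicator, indicator_of_mem hx]
  have h2 := ae_eq_zero_of_weak_gradient_ballIndicator hg h (U := (Metric.closedBall 0 1)ᶜ)
    Metric.isClosed_closedBall.isOpen_compl (c := 0) fun x hx => by
      rw [ballIndicator, indicator_of_notMem]
      exact fun hx' => hx (Metric.ball_subset_closedBall hx')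
  have h3 : ∀ᵐ x : E n, x ∉ Metric.sphere (0 : E n) 1 :=
    measure_eq_zero_iff_ae_notMem.1 (Measure.addHaar_sphere volume _ _)
  have hg0 : ∀ᵐ x, g x = 0 := by
    filter_upwards [h1, h2, h3] with x hx1 hx2 hx3
    simp only [Metric.mem_ball, mem_compl_iff, Metric.mem_closedBall, Metric.mem_sphere,
      not_le] at hx1 hx2 hx3
    rcases lt_trichotomy (dist x 0) 1 with h' | h' | h'
    · exact hx1 h'
    · exact absurd h' hx3
    · exact hx2 h'
  -- the identity field, cut off away from the ball
  let χ : ContDiffBump (0 : E n) := ⟨1, 2, one_pos, one_lt_two⟩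
  have hφ : IsTestField (fun x : E n => χ x • x) :=
    ⟨χ.contDiff.smul contDiff_id, χ.hasCompactSupport.smul_right⟩
  have hdiv : ∀ x ∈ Metric.ball (0 : E n) 1, divergence (fun x : E n => χ x • x) x = n := by
    intro x hx
    have heq : (fun x : E n => χ x • x) =ᶠ[𝓝 x] fun x => x := by
      filter_upwards [Metric.isOpen_ball.mem_nhds hx] with y hy
      rw [χ.one_of_mem_closedBall (Metric.ball_subset_closedBall hy), one_smul]
    unfold divergence
    rw [heq.fderiv_eq]
    simp
  have hL : ∫ x, ballIndicator n x * divergence (fun x : E n => χ x • x) x =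
      ∫ x, (Metric.ball (0 : E n) 1).indicator (fun _ => (n : ℝ)) x := by
    congr 1; ext x
    by_cases hx : x ∈ Metric.ball (0 : E n) 1
    · simp [ballIndicator, indicator_of_mem hx, hdiv x hx]
    · simp [ballIndicator, indicator_of_notMem hx]
  have hR : ∫ x, ⟪g x, χ x • x⟫ = 0 := by
    rw [integral_eq_zero_of_ae]
    filter_upwards [hg0] with x hx
    simp [hx]
  have := h _ hφ
  rw [hL, hR, integral_indicator_const _ measurableSet_ball, neg_zero, smul_eq_mul,
    mul_eq_zero] at this
  rcases this with h0 | h0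
  · exact (ENNReal.toReal_pos (Metric.measure_ball_pos volume (0 : E n) one_pos).ne'
      measure_ball_lt_top.ne).ne' h0
  · exact absurd (Nat.cast_eq_zero.1 h0) (by omega)

/-! ### The gradient measure of a function of bounded variation -/

/-- Weak-* compactness of bounded sequences of nonnegative densities. The cluster point is taken
along a fixed nonprincipal ultrafilter, so that it is additive in the test function and is
represented by a measure. -/
lemma exists_measure_tendsto_hyperfilter {p : ℕ → E n → ℝ} (hp : ∀ k, Integrable (p k))
    (hp0 : ∀ k x, 0 ≤ p k x) {V : ℝ} (hV : ∀ k, ∫ x, p k x ≤ V) :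
    ∃ P : Measure (E n), IsFiniteMeasure P ∧ ∀ ψ : C_c(E n, ℝ),
      Tendsto (fun k => ∫ x, ψ x * p k x) (hyperfilter ℕ) (𝓝 (∫ x, ψ x ∂P)) := by
  have hint : ∀ (ψ : C_c(E n, ℝ)) k, Integrable fun x => ψ x * p k x := by
    intro ψ k
    obtain ⟨A, hA⟩ := ψ.hasCompactSupport.exists_bound_of_continuous ψ.continuous
    exact (hp k).bdd_mul ψ.continuous.aestronglyMeasurable (Eventually.of_forall hA)
  have hbound : ∀ (ψ : C_c(E n, ℝ)) (A : ℝ), 0 ≤ A → (∀ x, ‖ψ x‖ ≤ A) → ∀ k,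
      |∫ x, ψ x * p k x| ≤ A * V := by
    intro ψ A hA0 hA k
    rw [← Real.norm_eq_abs]
    refine (norm_integral_le_of_norm_le ((hp k).const_mul A)
      (Eventually.of_forall fun x => ?_)).trans ?_
    · rw [norm_mul, Real.norm_of_nonneg (hp0 k x)]
      exact mul_le_mul_of_nonneg_right (hA x) (hp0 k x)
    · rw [integral_const_mul]
      exact mul_le_mul_of_nonneg_left (hV k) hA0
  have hex : ∀ ψ : C_c(E n, ℝ), ∃ L : ℝ,
      Tendsto (fun k => ∫ x, ψ x * p k x) (hyperfilter ℕ) (𝓝 L) := by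
    intro ψ
    obtain ⟨A, hA⟩ := ψ.hasCompactSupport.exists_bound_of_continuous ψ.continuous
    have hA0 : 0 ≤ A := (norm_nonneg _).trans (hA 0)
    obtain ⟨L, -, hL⟩ := (isCompact_Icc (a := -(A * V)) (b := A * V)).ultrafilter_le_nhds'
      ((hyperfilter ℕ).map fun k => ∫ x, ψ x * p k x)
      (Ultrafilter.mem_map.2 (Filter.univ_mem' fun k => abs_le.1 (hbound ψ A hA0 hA k)))
    exact ⟨L, hL⟩
  choose L hL using hex
  let Λ : C_c(E n, ℝ) →ₚ[ℝ] ℝ := .mk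
    { toFun := L
      map_add' := fun ψ χ => by
        refine tendsto_nhds_unique (hL (ψ + χ)) (((hL ψ).add (hL χ)).congr fun k => ?_)
        rw [← integral_add (hint ψ k) (hint χ k)]
        simp [add_mul]
      map_smul' := fun c ψ => by
        refine tendsto_nhds_unique (hL (c • ψ)) (((hL ψ).const_mul c).congr fun k => ?_)
        rw [← integral_const_mul]
        simp [mul_assoc] }
    (fun ψ χ hψχ => le_of_tendsto_of_tendsto' (hL ψ) (hL χ) fun k =>
      integral_mono (hint ψ k) (hint χ k) fun x =>
        mul_le_mul_of_nonneg_right (hψχ x) (hp0 k x))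
  have hΛ : ∀ ψ, Λ ψ = L ψ := fun ψ => rfl
  refine ⟨RealRMK.rieszMeasure Λ, ⟨?_⟩, fun ψ => ?_⟩
  · have : (RealRMK.rieszMeasure Λ).Regular := inferInstance
    refine lt_of_le_of_lt (b := ENNReal.ofReal V) ?_ ENNReal.ofReal_lt_top
    rw [isOpen_univ.measure_eq_iSup_isCompact]
    refine iSup_le fun K => iSup_le fun _ => iSup_le fun hK => ?_
    obtain ⟨f, hf1, -, hfc, hf01⟩ := exists_continuous_one_zero_of_isCompact hK isClosed_empty
      (disjoint_empty K)
    let F : C_c(E n, ℝ) := ⟨f, hfc⟩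
    refine (RealRMK.rieszMeasure_le_of_eq_one Λ (f := F) (fun x => (hf01 x).1) hK
      (fun x hx => hf1 hx)).trans (ENNReal.ofReal_le_ofReal ?_)
    rw [hΛ]
    refine le_of_tendsto' (hL F) fun k => ?_
    have := hbound F 1 zero_le_one (fun x => by
      change ‖f x‖ ≤ 1
      rw [Real.norm_of_nonneg (hf01 x).1]; exact (hf01 x).2) k
    rw [one_mul] at this
    exact (le_abs_self _).trans this
  · rw [RealRMK.integral_rieszMeasure, hΛ]
    exact hL ψ

/-- The partial derivatives of a function of bounded variation are differences of two finite
measures. -/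
lemma exists_measure_partial {u : E n → ℝ} (hu : Integrable u) (hV : variation u < ⊤)
    (i : Fin n) : ∃ P N : Measure (E n), IsFiniteMeasure P ∧ IsFiniteMeasure N ∧
      ∀ ψ, IsTestFun ψ → ∫ x, u x * fderiv ℝ ψ x (EuclideanSpace.single i (1 : ℝ)) =
        ∫ x, ψ x ∂P - ∫ x, ψ x ∂N := by
  set t : ℕ → ℝ := fun k => 1 / ((k : ℝ) + 1)
  have ht : ∀ k, 0 < t k := fun k => by positivity
  set w : ℕ → E n → ℝ := fun k x =>
    (t k)⁻¹ * (u (x + (-t k) • EuclideanSpace.single i (1 : ℝ)) - u x)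
  have hw : ∀ k, Integrable (w k) := fun k => ((hu.comp_add_right _).sub hu).const_mul _
  have hwV : ∀ k, ∫ x, |w k x| ≤ (variation u).toReal := fun k =>
    integral_abs_diffQuot_le (fun z => by
      rw [mul_comm]; exact integral_abs_translate_sub_le hu hV z) i (ht k)
  obtain ⟨P, hP, hPt⟩ := exists_measure_tendsto_hyperfilter (p := fun k x => max (w k x) 0)
    (fun k => (hw k).pos_part) (fun k x => le_max_right _ _)
    (fun k => (integral_mono (hw k).pos_part (hw k).abs fun x =>
      max_le (le_abs_self _) (abs_nonneg _)).trans (hwV k))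
  obtain ⟨N, hN, hNt⟩ := exists_measure_tendsto_hyperfilter (p := fun k x => max (-w k x) 0)
    (fun k => (hw k).neg_part) (fun k x => le_max_right _ _)
    (fun k => (integral_mono (hw k).neg_part (hw k).abs fun x =>
      max_le (neg_le_abs _) (abs_nonneg _)).trans (hwV k))
  refine ⟨P, N, hP, hN, fun ψ hψ => ?_⟩
  let Ψ : C_c(E n, ℝ) := ⟨⟨ψ, hψ.continuous⟩, hψ.2⟩
  have h1 := (tendsto_integral_diffQuot_mul hu hψ (EuclideanSpace.single i (1 : ℝ))
    tendsto_one_div_add_one_nhdsNE).mono_left Nat.hyperfilter_le_atTop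
  refine tendsto_nhds_unique h1 (((hPt Ψ).sub (hNt Ψ)).congr fun k => ?_)
  have hm : ∀ v : E n → ℝ, Integrable v → Integrable fun x => Ψ x * v x := fun v hv =>
    (hψ.integrable_mul hv).congr (Eventually.of_forall fun _ => mul_comm _ _)
  rw [← integral_sub (hm _ (hw k).pos_part) (hm _ (hw k).neg_part)]
  congr 1; ext x
  rw [← mul_sub, max_zero_sub_max_neg_zero_eq_self, mul_comm]
  rfl

lemma IsTestField.exists_bound {φ : E n → E n} (hφ : IsTestField φ) :
    ∃ C, 0 ≤ C ∧ ∀ x, ‖φ x‖ ≤ C := by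
  obtain ⟨C, hC⟩ := hφ.2.exists_bound_of_continuous hφ.1.continuous
  exact ⟨C, (norm_nonneg _).trans (hC 0), hC⟩

/-- The distributional gradient of a function of bounded variation, as a density with respect to a
finite measure. -/
lemma exists_gradient_density {u : E n → ℝ} (hu : Integrable u) (hV : variation u < ⊤) :
    ∃ (m : Measure (E n)) (G : E n → E n), IsFiniteMeasure m ∧ Measurable G ∧ Integrable G m ∧
      ∀ φ, IsTestField φ → ∫ x, u x * divergence φ x = -∫ x, ⟪φ x, G x⟫ ∂m := by
  choose P N hP hN h using exists_measure_partial hu hV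
  -- a single finite measure dominating all the parts `P i`, `N i`
  set m : Measure (E n) := ∑ i, (P i + N i)
  have hm : IsFiniteMeasure m := inferInstance
  have hle : ∀ i, P i + N i ≤ m := fun i =>
    Finset.single_le_sum (f := fun i => P i + N i) (fun _ _ => Measure.zero_le _)
      (Finset.mem_univ i)
  have hPm : ∀ i, P i ≪ m := fun i =>
    Measure.absolutelyContinuous_of_le ((Measure.le_add_right le_rfl).trans (hle i))
  have hNm : ∀ i, N i ≪ m := fun i =>
    Measure.absolutelyContinuous_of_le ((Measure.le_add_left le_rfl).trans (hle i))
  set G : E n → E n := fun x => WithLp.toLp 2 fun i =>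
    ((N i).rnDeriv m x).toReal - ((P i).rnDeriv m x).toReal
  have hGi : Integrable G m := by
    rw [integrable_piLp_iff]
    exact fun i => Measure.integrable_toReal_rnDeriv.sub Measure.integrable_toReal_rnDeriv
  refine ⟨m, G, hm, ?_, hGi, fun φ hφ => ?_⟩
  · refine (PiLp.continuous_toLp 2 _).measurable.comp (measurable_pi_lambda _ fun i => ?_)
    exact ((N i).measurable_rnDeriv m).ennreal_toReal.sub
      ((P i).measurable_rnDeriv m).ennreal_toReal
  · rw [integral_mul_divergence hφ hu, ← integral_neg]
    obtain ⟨C, -, hC⟩ := hφ.exists_bound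
    have hi : ∀ i (Q : Measure (E n)) [IsFiniteMeasure Q],
        Integrable (fun x => (Q.rnDeriv m x).toReal * φ x i) m := fun i Q _ =>
      Measure.integrable_toReal_rnDeriv.mul_bdd
        (hφ.component i).continuous.aestronglyMeasurable
        (Eventually.of_forall fun x => (PiLp.norm_apply_le (φ x) i).trans (hC x))
    have e1 : ∀ x, -⟪φ x, G x⟫ = ∑ i, (((P i).rnDeriv m x).toReal * φ x i -
        ((N i).rnDeriv m x).toReal * φ x i) := by
      intro x
      rw [PiLp.inner_apply, ← Finset.sum_neg_distrib]
      refine Finset.sum_congr rfl fun i _ => ?_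
      simp [G]; ring
    simp_rw [e1]
    have hd : ∀ i, Integrable (fun x => ((P i).rnDeriv m x).toReal * φ x i -
        ((N i).rnDeriv m x).toReal * φ x i) m := fun i => (hi i (P i)).sub (hi i (N i))
    rw [integral_finsetSum _ fun i _ => hd i]
    refine Finset.sum_congr rfl fun i _ => ?_
    rw [h i _ (hφ.component i), integral_sub (hi i (P i)) (hi i (N i))]
    congr 1
    · have := Measure.haveLebesgueDecomposition_of_sigmaFinite (P i) m
      exact (integral_rnDeriv_smul (hPm i)).symm
    · have := Measure.haveLebesgueDecomposition_of_sigmaFinite (N i) m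
      exact (integral_rnDeriv_smul (hNm i)).symm

/-- The pairing of a bounded field with a vector measure given by a density, by approximation with
simple functions. -/
lemma pairing_withDensity {m : Measure (E n)} {G : E n → E n} (hG : Integrable G m)
    {φ : E n → E n} (hφ : Measurable φ) {C : ℝ} (hC : ∀ x, ‖φ x‖ ≤ C) :
    pairing φ (m.withDensityᵥ G) = ∫ x, ⟪φ x, G x⟫ ∂m := by
  have hvar := Measure.variation_withDensityᵥ hG
  have hfin : IsFiniteMeasure (m.withDensityᵥ G).variation := by
    rw [hvar]
    exact ⟨by rw [withDensity_apply _ MeasurableSet.univ, setLIntegral_univ]; exact hG.2⟩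
  have hinner : ∀ f : SimpleFunc (E n) (E n), Integrable (fun x => ⟪f x, G x⟫) m := by
    intro f
    obtain ⟨A, hA⟩ := f.exists_forall_norm_le
    refine (hG.norm.const_mul A).mono' (f.aestronglyMeasurable.inner hG.aestronglyMeasurable)
      (Eventually.of_forall fun x => (norm_inner_le_norm _ _).trans ?_)
    exact mul_le_mul_of_nonneg_right (hA x) (norm_nonneg _)
  have hsimp : ∀ f : SimpleFunc (E n) (E n),
      pairing f (m.withDensityᵥ G) = ∫ x, ⟪f x, G x⟫ ∂m := by
    intro f
    induction f using SimpleFunc.induction with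
    | @const c s hs =>
      simp only [SimpleFunc.coe_piecewise, SimpleFunc.coe_const, Function.const_zero,
        piecewise_eq_indicator]
      rw [pairing]
      have h1 := VectorMeasure.integral_indicator_const (μ := m.withDensityᵥ G)
        (B := innerSL ℝ) c hs
      have h2 : (fun x => s.indicator (fun _ => c) x) = s.indicator (Function.const (E n) c) := rfl
      rw [h2] at h1
      rw [h1, withDensityᵥ_apply hG hs]
      have h3 : ∀ x, ⟪s.indicator (Function.const (E n) c) x, G x⟫ =
          s.indicator (fun x => ⟪c, G x⟫) x := by
        intro x; by_cases hx : x ∈ s <;> simp [hx]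
      simp_rw [h3]
      rw [integral_indicator hs]
      exact (integral_inner hG.integrableOn c).symm
    | @add f g _ hf hg =>
      have hfi : ∀ f : SimpleFunc (E n) (E n), (m.withDensityᵥ G).Integrable f := fun f =>
        f.integrable_of_isFiniteMeasure
      have h1 : pairing (f + g : SimpleFunc (E n) (E n)) (m.withDensityᵥ G) =
          pairing f (m.withDensityᵥ G) + pairing g (m.withDensityᵥ G) :=
        VectorMeasure.integral_add (hfi f) (hfi g)
      rw [h1, hf, hg, ← integral_add (hinner f) (hinner g)]
      simp [inner_add_left]
  set F : ℕ → SimpleFunc (E n) (E n) := fun k => SimpleFunc.approxOn φ hφ univ 0 (mem_univ 0) k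
  have hF : ∀ x, Tendsto (fun k => F k x) atTop (𝓝 (φ x)) := fun x =>
    SimpleFunc.tendsto_approxOn hφ (mem_univ 0) (by simp)
  have hFb : ∀ k x, ‖F k x‖ ≤ C + C := fun k x =>
    (SimpleFunc.norm_approxOn_zero_le hφ (mem_univ 0) x k).trans (add_le_add (hC x) (hC x))
  have hl : Tendsto (fun k => pairing (F k) (m.withDensityᵥ G)) atTop
      (𝓝 (pairing φ (m.withDensityᵥ G))) :=
    VectorMeasure.tendsto_integral_of_dominated_convergence (fun _ => C + C)
      (fun k => (F k).aestronglyMeasurable) (integrable_const _)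
      (fun k => Eventually.of_forall (hFb k)) (Eventually.of_forall hF)
  have hr : Tendsto (fun k => ∫ x, ⟪F k x, G x⟫ ∂m) atTop (𝓝 (∫ x, ⟪φ x, G x⟫ ∂m)) :=
    tendsto_integral_of_dominated_convergence (fun x => (C + C) * ‖G x‖)
      (fun k => (hinner (F k)).aestronglyMeasurable) (hG.norm.const_mul _)
      (fun k => Eventually.of_forall fun x => (norm_inner_le_norm _ _).trans
        (mul_le_mul_of_nonneg_right (hFb k x) (norm_nonneg _)))
      (Eventually.of_forall fun x => (hF x).inner tendsto_const_nhds)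
  refine tendsto_nhds_unique hl (hr.congr fun k => (hsimp _).symm)

/-- A density whose total variation is absolutely continuous is an integrable field
(Radon–Nikodym and the polar decomposition). -/
lemma exists_integrable_of_absolutelyContinuous {m : Measure (E n)} {G : E n → E n}
    (hGm : Measurable G) (hG : Integrable G m)
    (hac : m.withDensity (fun x => ‖G x‖ₑ) ≪ (volume : Measure (E n))) :
    ∃ g : E n → E n, Integrable g ∧ ∀ φ : E n → E n,
      ∫ x, ⟪φ x, G x⟫ ∂m = ∫ x, ⟪g x, φ x⟫ := by
  set ρ := m.withDensity fun x => ‖G x‖ₑ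
  have hρ : IsFiniteMeasure ρ :=
    ⟨by rw [withDensity_apply _ MeasurableSet.univ, setLIntegral_univ]; exact hG.2⟩
  refine ⟨fun x => (ρ.rnDeriv volume x).toReal • (‖G x‖⁻¹ • G x), ?_, fun φ => ?_⟩
  · refine (Measure.integrable_toReal_rnDeriv (μ := ρ) (ν := volume)).mono'
      ((ρ.measurable_rnDeriv volume).ennreal_toReal.smul
        (hGm.norm.inv.smul hGm)).aestronglyMeasurable (Eventually.of_forall fun x => ?_)
    rw [norm_smul, Real.norm_of_nonneg ENNReal.toReal_nonneg]
    refine mul_le_of_le_one_right ENNReal.toReal_nonneg ?_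
    rw [norm_smul, norm_inv, norm_norm]
    exact inv_mul_le_one
  · simp_rw [real_inner_smul_left]
    have h1 := integral_rnDeriv_smul hac (f := fun x => ‖G x‖⁻¹ * ⟪G x, φ x⟫)
    simp only [smul_eq_mul] at h1
    rw [h1, integral_withDensity_eq_integral_toReal_smul hGm.enorm
      (Eventually.of_forall fun x => enorm_lt_top)]
    congr 1; ext x
    rw [toReal_enorm, smul_eq_mul, real_inner_comm]
    rcases eq_or_ne (G x) 0 with h0 | h0
    · simp [h0]
    · rw [← mul_assoc, mul_inv_cancel₀ (norm_ne_zero_iff.2 h0), one_mul]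

/-! ### Fractional Laplacians of functions of bounded variation -/

/-- `BV ⊂ W^{β,1}`: the modulus of continuity in `L¹` is `O(min(1, |z|))`. -/
lemma mem_fracW_of_mem_BV (hn : 1 ≤ n) {β : ℝ} (hβ0 : 0 < β) (hβ1 : β < 1) {u : E n → ℝ}
    (hu : u ∈ BV n) : u ∈ fracW n β := by
  have hi := memLp_one_iff_integrable.1 hu.1
  refine mem_fracW_iff.2 ⟨hi, integrable_levyIntegrand_of_translate hn hβ0 hβ1 hi
    (C := (variation u).toReal + 2 * ∫ x, |u x|) fun z => ?_⟩
  have hV0 : 0 ≤ (variation u).toReal := ENNReal.toReal_nonneg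
  have hI0 : 0 ≤ 2 * ∫ x, |u x| := by positivity
  rcases le_total 1 ‖z‖ with hz | hz
  · rw [min_eq_left hz, mul_one]
    exact (integral_abs_translate_sub_le_two_mul hi z).trans (le_add_of_nonneg_left hV0)
  · rw [min_eq_right hz, mul_comm]
    exact (integral_abs_translate_sub_le hi hu.2 z).trans
      (mul_le_mul_of_nonneg_left (le_add_of_nonneg_right hI0) (norm_nonneg z))

/-- `D^α ((-Δ)^{(1-α)/2} u) = D u` in the sense of distributions. -/
lemma integral_fracLaplacian_mul_fracDiv_of_mem_BV (hn : 1 ≤ n) {α : ℝ} (hα0 : 0 < α) (hα1 : α < 1)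
    {u : E n → ℝ} (hu : u ∈ BV n) {φ : E n → E n} (hφ : IsTestField φ) :
    ∫ x, fracLaplacian (1 - α) u x * fracDiv α φ x = ∫ x, u x * divergence φ x := by
  obtain ⟨hi, hl⟩ := mem_fracW_iff.1
    (mem_fracW_of_mem_BV hn (β := 1 - α) (by linarith) (by linarith) hu)
  exact integral_fracLaplacian_mul_fracDiv hn hα0 hα1 hi hl hφ

lemma fracLaplacian_mem_fracBV (hn : 1 ≤ n) {α : ℝ} (hα0 : 0 < α) (hα1 : α < 1)
    {u : E n → ℝ} (hu : u ∈ BV n) : fracLaplacian (1 - α) u ∈ fracBV n α := by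
  refine ⟨memLp_one_iff_integrable.2 (integrable_fracLaplacian (mem_fracW_iff.1
    (mem_fracW_of_mem_BV hn (by linarith) (by linarith) hu)).2), lt_of_le_of_lt ?_ hu.2⟩
  refine iSup_mono fun φ => iSup_mono fun hφ => iSup_mono fun _ => le_of_eq ?_
  rw [integral_fracLaplacian_mul_fracDiv_of_mem_BV hn hα0 hα1 hu hφ]

lemma fracLaplacian_notMem_fracS (hn : 1 ≤ n) {α : ℝ} (hα0 : 0 < α) (hα1 : α < 1)
    {u : E n → ℝ} (hu : u ∈ BV n \ W11 n) : fracLaplacian (1 - α) u ∉ fracS n α := by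
  rintro ⟨-, g, hg, h⟩
  refine hu.2 ⟨hu.1.1, g, hg, fun φ hφ => ?_⟩
  rw [← h φ hφ, integral_fracLaplacian_mul_fracDiv_of_mem_BV hn hα0 hα1 hu.1 hφ]

/-- A function of bounded variation has a gradient measure; if the total variation of this measure
were absolutely continuous, its Radon–Nikodym density would be an integrable weak gradient. -/
lemma exists_isGradientMeasure {u : E n → ℝ} (hu : u ∈ BV n \ W11 n) :
    ∃ μ : VectorMeasure (E n) (E n), IsGradientMeasure u μ ∧
      ¬ μ.variation ≪ (volume : Measure (E n)) := by
  obtain ⟨m, G, hm, hGm, hG, h⟩ :=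
    exists_gradient_density (memLp_one_iff_integrable.1 hu.1.1) hu.1.2
  have hvar := Measure.variation_withDensityᵥ hG
  refine ⟨m.withDensityᵥ G, ⟨?_, fun φ hφ => ?_⟩, fun hac => ?_⟩
  · rw [hvar]
    exact ⟨by rw [withDensity_apply _ MeasurableSet.univ, setLIntegral_univ]; exact hG.2⟩
  · obtain ⟨C, -, hC⟩ := hφ.exists_bound
    rw [h φ hφ, pairing_withDensity hG hφ.1.continuous.measurable hC]
  · rw [hvar] at hac
    obtain ⟨g, hg, hgG⟩ := exists_integrable_of_absolutelyContinuous hGm hG hac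
    exact hu.2 ⟨hu.1.1, g, memLp_one_iff_integrable.2 hg, fun φ hφ => by rw [h φ hφ, hgG]⟩

end FracBV

theorem mainTheorem10 (n : ℕ) (hn : 1 ≤ n) (α : ℝ) (hα0 : 0 < α) (hα1 : α < 1) :
    FracBV.fracS n α ⊂ FracBV.fracBV n α ∧
    FracBV.fracW n α ⊂ FracBV.fracBV n α ∧
    (FracBV.BV n \ FracBV.W11 n).Nonempty ∧
    ∀ u ∈ FracBV.BV n \ FracBV.W11 n,
      u ∈ FracBV.fracW n (1 - α) ∧
      FracBV.fracLaplacian (1 - α) u ∈ FracBV.fracBV n α \ FracBV.fracS n α ∧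
      ∃ μ : VectorMeasure (FracBV.E n) (FracBV.E n),
        FracBV.IsGradientMeasure u μ ∧
        FracBV.IsFracGradientMeasure α (FracBV.fracLaplacian (1 - α) u) μ ∧
        ¬ μ.variation ≪ (volume : Measure (FracBV.E n)) := by
  open FracBV in
  have hball : ballIndicator n ∈ BV n \ W11 n :=
    ⟨ballIndicator_mem_BV n, ballIndicator_notMem_W11 hn⟩
  have hmem := fracLaplacian_mem_fracBV hn hα0 hα1 hball.1
  have hnot := fracLaplacian_notMem_fracS hn hα0 hα1 hball
  have hWS := fracW_subset_fracS hn hα0 hα1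
  refine ⟨⟨fracS_subset_fracBV n α, fun h => hnot (h hmem)⟩,
    ⟨hWS.trans (fracS_subset_fracBV n α), fun h => hnot (hWS (h hmem))⟩,
    ⟨_, hball⟩, fun u hu => ⟨mem_fracW_of_mem_BV hn (by linarith) (by linarith) hu.1,
      ⟨fracLaplacian_mem_fracBV hn hα0 hα1 hu.1, fracLaplacian_notMem_fracS hn hα0 hα1 hu⟩, ?_⟩⟩
  obtain ⟨μ, hμ, hac⟩ := exists_isGradientMeasure hu
  refine ⟨μ, hμ, ⟨hμ.1, fun φ hφ => ?_⟩, hac⟩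
  rw [integral_fracLaplacian_mul_fracDiv_of_mem_BV hn hα0 hα1 hu.1 hφ, hμ.2 φ hφ]
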